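/- Let $\mathcal{D}$ be a probability distribution on a measurable space $\mathcal{Z}$ and let $f:\mathbb{R}^d\times\mathcal{Z}\to[0,1]$ be a loss such that $f(\boldsymbol{w},\cdot)$ is measurable for every $\boldsymbol{w}$ and $f(\cdot,z)$ is twice continuously differentiable for every $z$. Assume that $f$ is $L$-Lipschitz ($\|\nabla f(\boldsymbol{w},z)\|\le L$), $\beta$-smooth ($\|\nabla f(\boldsymbol{w},z)-\nabla f(\boldsymbol{v},z)\|\le\beta\|\boldsymbol{w}-\boldsymbol{v}\|$, $\beta>0$) and has a $\rho$-Lipschitz Hessian ($\|\nabla^2 f(\boldsymbol{w},z)-\nabla^2 f(\boldsymbol{v},z)\|_2\le\rho\|\boldsymbol{w}-\boldsymbol{v}\|$, $\rho\ge 0$), for all $\boldsymbol{w},\boldsymbol{v},z$. Write $R(\boldsymbol{w})=\mathbb{E}_{z\sim\mathcal{D}}f(\boldsymbol{w},z)$ and $R^\star=\inf_{\boldsymbol{w}}R(\boldsymbol{w})$. Let $1\le T\le m$, let $S=(z_1,\dots,z_m)\sim\mathcal{D}^m$, and let SGD perform, from $\boldsymbol{w}_1\in\mathbb{R}^d$,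 the updates $\boldsymbol{w}_{S,t+1}=\boldsymbol{w}_{S,t}-\alpha_t\nabla f(\boldsymbol{w}_{S,t},z_{j_t})$ with $\boldsymbol{w}_{S,1}=\boldsymbol{w}_1$, where the indices $j_1,\dots,j_T$ are drawn uniformly without replacement from $\{1,\dots,m\}$; $\mathbb{E}_A$ denotes the expectation over these indices. Let $\sigma\ge0$ be such that $\mathbb{E}_A\mathbb{E}_{S,z}\|\nabla f(\boldsymbol{w}_{S,t},z)-\nabla R(\boldsymbol{w}_{S,t})\|^2\le\sigma^2$ for all $t\in\{1,\dots,T\}$, where $z\sim\mathcal{D}$ is independent of $S$. Let $\alpha_t=c/t$ with $c>0$ and $$c\le\min\Big\{\frac1\beta,\ \frac{1}{4(2\beta\ln T)^2},\ \frac{1}{2(2\beta\ln T)}\Big\}$$ (for $T=1$ the last two terms are read as $+\infty$; the third condition follows from the second whenever $\beta\ln T\ge 1/4$). Then there is a universal constant $C>0$ (independent of all the quantities above) such that, for every $\gamma>0$ with $$\gamma\ \ge\ C\,\min\Big\{\beta,\ \mathbb{E}_z\|\nabla^2f(\boldsymbol{w}_1,z)\|_2+(1+\ln T)\,\rho\Big(c\sigma+\sqrt{c\,(R(\boldsymbol{w}_1)-R^\star)}\Big)\Big\},$$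 in particular for $\gamma$ equal to the right-hand side when that is positive, SGD is on-average stable with $$\sup_{1\le i\le m}\mathbb{E}_A\mathbb{E}_{S,z}\big[f(A_S,z)-f(A_{S^{(i)}},z)\big]\ \le\ \frac{1+\frac1{c\gamma}}{m}\,(2cL^2)^{\frac1{1+c\gamma}}\,\big(\mathbb{E}_{S,A}[R(A_S)]\cdot T\big)^{\frac{c\gamma}{1+c\gamma}}.$$ Here $z\sim\mathcal{D}$ is independent of $S$, $S^{(i)}$ is $S$ with its $i$-th example replaced by $z$, and the output $A_S$ may be taken to be either $\boldsymbol{w}_{S,T}$ or $\boldsymbol{w}_{S,T+1}$. -/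

import Mathlib

open MeasureTheory
open scoped BigOperators

/-- The gradient `∇ f(w, z)` of the loss with respect to the parameter. -/
noncomputable def lossGrad {d : ℕ} {Z : Type*} (f : EuclideanSpace ℝ (Fin d) → Z → ℝ)
    (w : EuclideanSpace ℝ (Fin d)) (z : Z) : EuclideanSpace ℝ (Fin d) :=
  gradient (fun v => f v z) w

/-- The Hessian `∇² f(w, z)` of the loss with respect to the parameter, as a linear operator;
its norm is the spectral norm. -/
noncomputable def lossHess {d : ℕ} {Z : Type*} (f : EuclideanSpace ℝ (Fin d) → Z → ℝ)
    (w : EuclideanSpace ℝ (Fin d)) (z : Z) :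
    EuclideanSpace ℝ (Fin d) →L[ℝ] EuclideanSpace ℝ (Fin d) :=
  fderiv ℝ (fun v => lossGrad f v z) w

/-- `L`-Lipschitz loss. -/
def IsLipschitzLoss {d : ℕ} {Z : Type*} (L : ℝ) (f : EuclideanSpace ℝ (Fin d) → Z → ℝ) : Prop :=
  ∀ w z, ‖lossGrad f w z‖ ≤ L

/-- `β`-smooth loss. -/
def IsSmoothLoss {d : ℕ} {Z : Type*} (β : ℝ) (f : EuclideanSpace ℝ (Fin d) → Z → ℝ) : Prop :=
  ∀ w v z, ‖lossGrad f w z - lossGrad f v z‖ ≤ β * ‖w - v‖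

/-- Loss with a `ρ`-Lipschitz Hessian (in spectral norm). -/
def HasLipschitzHessian {d : ℕ} {Z : Type*} (ρ : ℝ)
    (f : EuclideanSpace ℝ (Fin d) → Z → ℝ) : Prop :=
  ∀ w v z, ‖lossHess f w z - lossHess f v z‖ ≤ ρ * ‖w - v‖

/-- The risk `R(w) = E_{z ∼ D} f(w, z)`. -/
noncomputable def risk {d : ℕ} {Z : Type*} [MeasurableSpace Z] (D : Measure Z)
    (f : EuclideanSpace ℝ (Fin d) → Z → ℝ) (w : EuclideanSpace ℝ (Fin d)) : ℝ :=
  ∫ z, f w z ∂D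

/-- The law `D^m` of an i.i.d. training set of size `m`. -/
noncomputable def sampleLaw {Z : Type*} [MeasurableSpace Z] (D : Measure Z) (m : ℕ) :
    Measure (Fin m → Z) :=
  Measure.pi fun _ => D

/-- The parameter of SGD after `n` updates, started at `w₁`, on the training set `S` visited in the
order `π 0, π 1, …, π (m - 1)`. The `t`-th update (`t = 1, …, m`) uses step size `α t` and the
example `S (π (t - 1))`; there is no update after the training set is exhausted. -/
noncomputable def sgdAfter {d m : ℕ} {Z : Type*} (f : EuclideanSpace ℝ (Fin d) → Z → ℝ)
    (α : ℕ → ℝ) (w₁ : EuclideanSpace ℝ (Fin d)) (S : Fin m → Z) (π : Equiv.Perm (Fin m)) :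
    ℕ → EuclideanSpace ℝ (Fin d)
  | 0 => w₁
  | n + 1 =>
    if h : n < m then
      sgdAfter f α w₁ S π n - α (n + 1) • lossGrad f (sgdAfter f α w₁ S π n) (S (π ⟨n, h⟩))
    else sgdAfter f α w₁ S π n

/-- The iterate `w_{S,t}`, `t = 1, 2, …`, of SGD, where `w_{S,1} = w₁`: the parameter after `t - 1`
updates. Under a uniformly random `π`, the indices of the first `T ≤ m` updates are a uniform
sample without replacement from the `m` indices. -/
noncomputable def sgdIterate {d m : ℕ} {Z : Type*} (f : EuclideanSpace ℝ (Fin d) → Z → ℝ)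
    (α : ℕ → ℝ) (w₁ : EuclideanSpace ℝ (Fin d)) (t : ℕ) (S : Fin m → Z)
    (π : Equiv.Perm (Fin m)) : EuclideanSpace ℝ (Fin d) :=
  sgdAfter f α w₁ S π (t - 1)

/-- Expected risk `E_{S,A} R(A_S)` of the output of a randomized algorithm `A`, whose randomness is
uniform on the finite set `Ω`. -/
noncomputable def expectedRisk {d m : ℕ} {Z Ω : Type*} [MeasurableSpace Z] [Fintype Ω]
    (D : Measure Z) (f : EuclideanSpace ℝ (Fin d) → Z → ℝ)
    (A : (Fin m → Z) → Ω → EuclideanSpace ℝ (Fin d)) : ℝ :=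
  𝔼 ω, ∫ S, risk D f (A S ω) ∂(sampleLaw D m)

/-- On-average stability of a randomized algorithm `A`:
`sup_i E_A E_{S,z} [f(A_S, z) - f(A_{S^(i)}, z)] ≤ ε`, where `S ∼ D^m` and `z ∼ D` are independent
and `S^(i)` is `S` with its `i`-th example replaced by `z`. -/
def IsOnAverageStable {d m : ℕ} {Z Ω : Type*} [MeasurableSpace Z] [Fintype Ω]
    (D : Measure Z) (f : EuclideanSpace ℝ (Fin d) → Z → ℝ)
    (A : (Fin m → Z) → Ω → EuclideanSpace ℝ (Fin d)) (ε : ℝ) : Prop :=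
  ∀ i : Fin m,
    𝔼 ω, ∫ p : (Fin m → Z) × Z,
      (f (A p.1 ω) p.2 - f (A (Function.update p.1 i p.2) ω) p.2) ∂((sampleLaw D m).prod D) ≤ ε

/-!
The examples being i.i.d., every order of the training set gives the same expectations, so SGD can
be run in the natural order; a uniformly random order only makes the replaced example appear at a
uniformly random position `k + 1` (`expect_sgdIterate_sub`). Hence the stability is `1 / m` times
the sum over `k` of the mean effect `replacementEffect` of replacing the example of update
`k + 1`.

Each effect is at most the expected risk `r`, since the loss is nonnegative, and at most `L` times
the expected distance of the two runs. The runs part at update `k + 1` by at most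
`2 L c / (k + 1)`, and each later update number `s + 1` multiplies their distance by at most
`1 + (c / (s + 1)) ξ`, where the curvature `ξ` is bounded by `β` and by the Hessian at `w₁` plus
`ρ` times the distances travelled by the runs. The sum `X` of the numbers `c ξ / (s + 1)` lies in
`[0, 1]` by the condition on `c`, so `E exp X ≤ exp (2 E X)`, and `E X` only requires the expected
distance travelled. The latter is `O((1 + log T) (c σ + √(c (R(w₁) - R⋆))))`: this follows from
the Cauchy-Schwarz inequality and a pointwise form of the descent lemma (`risk_sub_smul_le`), once
the example of the next update is exchanged for a fresh one (`integral_sgdDirection`). So the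
effect of position `q = k + 1` is at most `min r (B q ^ (-(1 + a)))` with `a = c γ` and
`B = 2 c L² T ^ a` (`IsRegularLoss.integral_divergence_le`).

Comparing the sum over `q` with the primitive of `min r (B x ^ (-(1 + a)))`, whose two branches
meet at `x = (B / r) ^ (1 / (1 + a))`, gives the bound with its exact constants
(`sum_min_le_rpow`).
-/

/-! ### Calculus of the loss and of the risk -/

section Loss

variable {d : ℕ} {Z : Type*} {f : EuclideanSpace ℝ (Fin d) → Z → ℝ} {L β ρ : ℝ}

lemma hasGradientAt_loss (hf : ∀ z, ContDiff ℝ 2 (fun w => f w z))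
    (w : EuclideanSpace ℝ (Fin d)) (z : Z) :
    HasGradientAt (fun v => f v z) (lossGrad f w z) w :=
  ((hf z).differentiable (by norm_num) w).hasGradientAt

lemma abs_loss_sub_le (hf : ∀ z, ContDiff ℝ 2 (fun w => f w z)) (hL : IsLipschitzLoss L f)
    (w v : EuclideanSpace ℝ (Fin d)) (z : Z) : |f w z - f v z| ≤ L * ‖w - v‖ := by
  have h := Convex.norm_image_sub_le_of_norm_hasFDerivWithin_le (s := Set.univ) (C := L)
    (f := fun v => f v z) (x := v) (y := w)
    (fun x _ => (hasGradientAt_iff_hasFDerivAt.1 (hasGradientAt_loss hf x z)).hasFDerivWithinAt)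
    (fun x _ => by simpa using hL x z) convex_univ (Set.mem_univ _) (Set.mem_univ _)
  simpa using h

/-- A function with a `β`-Lipschitz gradient field `g` lies below its quadratic expansions. -/
lemma le_add_inner_add_sq_of_lipschitz_gradient {E : Type*} [NormedAddCommGroup E]
    [InnerProductSpace ℝ E] [CompleteSpace E] {F : E → ℝ} {g : E → E}
    (hF : ∀ x, HasGradientAt F (g x) x) (hg : ∀ x y, ‖g x - g y‖ ≤ β * ‖x - y‖) (w v : E) :
    F v ≤ F w + inner ℝ (g w) (v - w) + β / 2 * ‖v - w‖ ^ 2 := by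
  set u := v - w with hu
  let ψ : ℝ → ℝ := fun t => F (w + t • u) - t * inner ℝ (g w) u - β / 2 * t ^ 2 * ‖u‖ ^ 2
  have hder : ∀ t : ℝ, HasDerivAt ψ
      (inner ℝ (g (w + t • u)) u - inner ℝ (g w) u - β * t * ‖u‖ ^ 2) t := by
    intro t
    have h1 : HasDerivAt (fun t : ℝ => w + t • u) u t := by
      simpa using ((hasDerivAt_id t).smul_const u).const_add w
    have h2 := (hasGradientAt_iff_hasFDerivAt.1 (hF (w + t • u))).comp_hasDerivAt t h1
    have h3 := (hasDerivAt_id t).mul_const (inner ℝ (g w) u)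
    have h4 := (((hasDerivAt_id t).pow 2).const_mul (β / 2)).mul_const (‖u‖ ^ 2)
    refine ((h2.sub h3).sub h4).congr_deriv ?_
    simp only [InnerProductSpace.toDual_apply_apply, id]
    push_cast
    ring
  have hanti : AntitoneOn ψ (Set.Ici 0) := by
    refine antitoneOn_of_deriv_nonpos (convex_Ici 0)
      (fun t _ => (hder t).continuousAt.continuousWithinAt)
      (fun t _ => (hder t).differentiableAt.differentiableWithinAt) fun t ht => ?_
    rw [interior_Ici] at ht
    have ht : 0 < t := ht
    rw [(hder t).deriv, ← inner_sub_left]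
    have h1 := real_inner_le_norm (g (w + t • u) - g w) u
    have h2 := hg (w + t • u) w
    rw [add_sub_cancel_left, norm_smul, Real.norm_eq_abs, abs_of_pos ht] at h2
    nlinarith [mul_le_mul_of_nonneg_right h2 (norm_nonneg u)]
  have h := hanti (Set.mem_Ici.2 le_rfl) (Set.mem_Ici.2 zero_le_one) zero_le_one
  simp only [ψ, one_smul, zero_smul, hu, add_sub_cancel, add_zero] at h
  linarith

lemma differentiable_lossGrad (hf : ∀ z, ContDiff ℝ 2 (fun w => f w z)) (z : Z) :
    Differentiable ℝ (fun w => lossGrad f w z) := by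
  have h : ContDiff ℝ 1 (fderiv ℝ (fun w => f w z)) := (hf z).fderiv_right (by norm_num)
  exact (InnerProductSpace.toDual ℝ
    (EuclideanSpace ℝ (Fin d))).symm.toContinuousLinearEquiv.differentiable.comp
    (h.differentiable (by norm_num))

lemma continuous_lossGrad (hf : ∀ z, ContDiff ℝ 2 (fun w => f w z)) (z : Z) :
    Continuous (fun w => lossGrad f w z) :=
  (differentiable_lossGrad hf z).continuous

lemma norm_lossHess_le (hβ : 0 ≤ β) (hs : IsSmoothLoss β f)
    (w : EuclideanSpace ℝ (Fin d)) (z : Z) : ‖lossHess f w z‖ ≤ β :=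
  norm_fderiv_le_of_lip' ℝ hβ (Filter.Eventually.of_forall fun v => hs v w z)

/-- Near the initial point, the gradient of the loss is Lipschitz with a constant controlled by the
Hessian at the initial point. -/
lemma norm_lossGrad_sub_le (hf : ∀ z, ContDiff ℝ 2 (fun w => f w z)) (hρ : 0 ≤ ρ)
    (hH : HasLipschitzHessian ρ f) (w₁ w v : EuclideanSpace ℝ (Fin d)) (z : Z) :
    ‖lossGrad f w z - lossGrad f v z‖
      ≤ (‖lossHess f w₁ z‖ + ρ * (‖w - w₁‖ + ‖v - w₁‖)) * ‖w - v‖ := by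
  refine (convex_closedBall w₁ (‖w - w₁‖ + ‖v - w₁‖)).norm_image_sub_le_of_norm_fderiv_le
    (f := fun v => lossGrad f v z) (𝕜 := ℝ)
    (fun x _ => differentiable_lossGrad hf z x) (fun x hx => ?_) ?_ ?_
  · have h1 := hH x w₁ z
    rw [mem_closedBall_iff_norm] at hx
    have h2 := mul_le_mul_of_nonneg_left hx hρ
    have h3 := norm_le_norm_add_norm_sub' (lossHess f x z) (lossHess f w₁ z)
    change ‖lossHess f x z‖ ≤ _
    linarith
  · rw [mem_closedBall_iff_norm]
    linarith [norm_nonneg (w - w₁)]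
  · rw [mem_closedBall_iff_norm]
    linarith [norm_nonneg (v - w₁)]

variable [MeasurableSpace Z]

/-- A pointwise derivative in a fixed direction is a limit of difference quotients, hence
measurable in the parameter. -/
lemma measurable_fderiv_apply {E F : Type*} [NormedAddCommGroup E] [NormedSpace ℝ E]
    [NormedAddCommGroup F] [NormedSpace ℝ F] [MeasurableSpace F] [BorelSpace F]
    [SecondCountableTopology F]
    {g : E → Z → F} (hg : ∀ w, Measurable (g w)) {w : E}
    (hd : ∀ z, DifferentiableAt ℝ (fun v => g v z) w) (u : E) :
    Measurable (fun z => fderiv ℝ (fun v => g v z) w u) := by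
  refine measurable_of_tendsto_metrizable (f := fun (n : ℕ) z =>
    ((n : ℝ) + 1) • (g (w + (((n : ℝ) + 1)⁻¹) • u) z - g w z)) (fun n => ?_) ?_
  · exact ((hg _).sub (hg _)).const_smul _
  · refine tendsto_pi_nhds.2 fun z => ?_
    have h1 : Filter.Tendsto (fun n : ℕ => (n : ℝ) + 1) Filter.atTop Filter.atTop :=
      Filter.tendsto_atTop_add_const_right _ _ tendsto_natCast_atTop_atTop
    exact (hd z).hasFDerivAt.lim u (tendsto_norm_atTop_atTop.comp h1)

lemma measurable_lossGrad (hm : ∀ w, Measurable (f w)) (hf : ∀ z, ContDiff ℝ 2 (fun w => f w z))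
    (w : EuclideanSpace ℝ (Fin d)) : Measurable (lossGrad f w) := by
  have key : ∀ i : Fin d, Measurable fun z => lossGrad f w z i := by
    intro i
    convert measurable_fderiv_apply hm
      (fun z => (hf z).differentiable (by norm_num) w)
      (EuclideanSpace.single i (1 : ℝ)) using 2 with z
    rw [(hasGradientAt_iff_hasFDerivAt.1 (hasGradientAt_loss hf w z)).fderiv]
    simp [EuclideanSpace.inner_single_right]
  have h2 : Measurable fun z => WithLp.ofLp (lossGrad f w z) := measurable_pi_iff.2 key
  exact (MeasurableEquiv.toLp 2 (Fin d → ℝ)).measurable.comp h2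

lemma measurable_lossGrad_uncurry (hm : ∀ w, Measurable (f w))
    (hf : ∀ z, ContDiff ℝ 2 (fun w => f w z)) :
    Measurable (fun p : EuclideanSpace ℝ (Fin d) × Z => lossGrad f p.1 p.2) :=
  measurable_uncurry_of_continuous_of_measurable (u := lossGrad f)
    (continuous_lossGrad hf) (measurable_lossGrad hm hf)

lemma measurable_loss_uncurry (hm : ∀ w, Measurable (f w))
    (hf : ∀ z, ContDiff ℝ 2 (fun w => f w z)) :
    Measurable (fun p : EuclideanSpace ℝ (Fin d) × Z => f p.1 p.2) :=
  measurable_uncurry_of_continuous_of_measurable (u := f) (fun z => (hf z).continuous) hm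

lemma measurable_norm_lossHess (hm : ∀ w, Measurable (f w))
    (hf : ∀ z, ContDiff ℝ 2 (fun w => f w z)) (w : EuclideanSpace ℝ (Fin d)) :
    Measurable (fun z => ‖lossHess f w z‖) := by
  have hsum : ∀ z, lossHess f w z = ∑ i, ContinuousLinearMap.smulRightL ℝ
      (EuclideanSpace ℝ (Fin d)) (EuclideanSpace ℝ (Fin d)) (EuclideanSpace.proj i)
      (lossHess f w z (EuclideanSpace.single i (1 : ℝ))) := by
    intro z
    refine ContinuousLinearMap.coe_injective
      ((EuclideanSpace.basisFun (Fin d) ℝ).toBasis.ext fun j => ?_)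
    simp 
  rw [show (fun z => ‖lossHess f w z‖) = _ from funext fun z => congrArg norm (hsum z)]
  have hcont : Continuous fun x : Fin d → EuclideanSpace ℝ (Fin d) =>
      ‖∑ i, ContinuousLinearMap.smulRightL ℝ
      (EuclideanSpace ℝ (Fin d)) (EuclideanSpace ℝ (Fin d)) (EuclideanSpace.proj i) (x i)‖ := by
    fun_prop
  refine hcont.measurable.comp (measurable_pi_iff.2 fun i => ?_)
  exact measurable_fderiv_apply (measurable_lossGrad hm hf)
    (fun z => differentiable_lossGrad hf z w) _

lemma risk_nonneg {D : Measure Z} (h01 : ∀ w z, f w z ∈ Set.Icc (0 : ℝ) 1)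
    (w : EuclideanSpace ℝ (Fin d)) :
    0 ≤ risk D f w :=
  integral_nonneg fun z => (h01 w z).1

lemma iInf_risk_le {D : Measure Z} (h01 : ∀ w z, f w z ∈ Set.Icc (0 : ℝ) 1)
    (w : EuclideanSpace ℝ (Fin d)) :
    ⨅ v, risk D f v ≤ risk D f w :=
  ciInf_le ⟨0, by rintro _ ⟨v, rfl⟩; exact risk_nonneg h01 v⟩ w

variable {D : Measure Z} [IsProbabilityMeasure D]

lemma integrable_loss (hm : ∀ w, Measurable (f w)) (h01 : ∀ w z, f w z ∈ Set.Icc (0 : ℝ) 1)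
    (w : EuclideanSpace ℝ (Fin d)) : Integrable (f w) D :=
  Integrable.of_bound (hm w).aestronglyMeasurable 1 (Filter.Eventually.of_forall fun z => by
    rw [Real.norm_eq_abs, abs_of_nonneg (h01 w z).1]; exact (h01 w z).2)

lemma integrable_lossGrad (hm : ∀ w, Measurable (f w)) (hf : ∀ z, ContDiff ℝ 2 (fun w => f w z))
    (hL : IsLipschitzLoss L f) (w : EuclideanSpace ℝ (Fin d)) : Integrable (lossGrad f w) D :=
  Integrable.of_bound (measurable_lossGrad hm hf w).aestronglyMeasurable L
    (Filter.Eventually.of_forall (hL w))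

/-- Differentiation under the integral sign: the gradient of the risk is the mean gradient. -/
lemma hasGradientAt_risk (hm : ∀ w, Measurable (f w)) (h01 : ∀ w z, f w z ∈ Set.Icc (0 : ℝ) 1)
    (hf : ∀ z, ContDiff ℝ 2 (fun w => f w z)) (hL : IsLipschitzLoss L f)
    (w : EuclideanSpace ℝ (Fin d)) :
    HasGradientAt (risk D f) (∫ z, lossGrad f w z ∂D) w := by
  have hmeas := (measurable_lossGrad hm hf w)
  have h := hasFDerivAt_integral_of_dominated_loc_of_lip (μ := D) (𝕜 := ℝ) (F := f) (x₀ := w)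
    (bound := fun _ => L) (s := Set.univ)
    (F' := fun z => InnerProductSpace.toDual ℝ (EuclideanSpace ℝ (Fin d)) (lossGrad f w z))
    Filter.univ_mem
    (Filter.Eventually.of_forall fun v => (hm v).aestronglyMeasurable) (integrable_loss hm h01 w)
    ((InnerProductSpace.toDual ℝ (EuclideanSpace ℝ (Fin d))).continuous.comp_aestronglyMeasurable
      hmeas.aestronglyMeasurable)
    (Filter.Eventually.of_forall fun z => by
      refine LipschitzOnWith.of_dist_le_mul fun x _ y _ => ?_
      rw [Real.dist_eq, dist_eq_norm]
      refine (abs_loss_sub_le hf hL x y z).trans ?_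
      gcongr
      exact le_abs_self L)
    (integrable_const L)
    (Filter.Eventually.of_forall fun z =>
      hasGradientAt_iff_hasFDerivAt.1 (hasGradientAt_loss hf w z))
  rw [hasGradientAt_iff_hasFDerivAt]
  have h2 := h.2
  have h3 := (innerSL ℝ (E := EuclideanSpace ℝ (Fin d))).integral_comp_comm
    (integrable_lossGrad (D := D) hm hf hL w)
  exact h2.congr_fderiv h3

lemma gradient_risk (hm : ∀ w, Measurable (f w)) (h01 : ∀ w z, f w z ∈ Set.Icc (0 : ℝ) 1)
    (hf : ∀ z, ContDiff ℝ 2 (fun w => f w z)) (hL : IsLipschitzLoss L f)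
    (w : EuclideanSpace ℝ (Fin d)) :
    gradient (risk D f) w = ∫ z, lossGrad f w z ∂D :=
  (hasGradientAt_risk hm h01 hf hL w).gradient

lemma norm_gradient_risk_le (hm : ∀ w, Measurable (f w)) (h01 : ∀ w z, f w z ∈ Set.Icc (0 : ℝ) 1)
    (hf : ∀ z, ContDiff ℝ 2 (fun w => f w z)) (hL : IsLipschitzLoss L f)
    (w : EuclideanSpace ℝ (Fin d)) : ‖gradient (risk D f) w‖ ≤ L := by
  rw [gradient_risk hm h01 hf hL]
  simpa using norm_integral_le_of_norm_le_const (μ := D) (Filter.Eventually.of_forall (hL w))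

lemma norm_gradient_risk_sub_le (hm : ∀ w, Measurable (f w))
    (h01 : ∀ w z, f w z ∈ Set.Icc (0 : ℝ) 1)
    (hf : ∀ z, ContDiff ℝ 2 (fun w => f w z)) (hL : IsLipschitzLoss L f) (hs : IsSmoothLoss β f)
    (w v : EuclideanSpace ℝ (Fin d)) :
    ‖gradient (risk D f) w - gradient (risk D f) v‖ ≤ β * ‖w - v‖ := by
  rw [gradient_risk hm h01 hf hL, gradient_risk hm h01 hf hL, ← integral_sub
    (integrable_lossGrad hm hf hL w) (integrable_lossGrad hm hf hL v)]
  simpa using norm_integral_le_of_norm_le_const (μ := D) (Filter.Eventually.of_forall (hs w v))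

lemma continuous_gradient_risk (hm : ∀ w, Measurable (f w))
    (h01 : ∀ w z, f w z ∈ Set.Icc (0 : ℝ) 1)
    (hf : ∀ z, ContDiff ℝ 2 (fun w => f w z)) (hL : IsLipschitzLoss L f) (hs : IsSmoothLoss β f) :
    Continuous (gradient (risk D f)) := by
  refine (LipschitzWith.of_dist_le_mul (K := Real.nnabs β) fun x y => ?_).continuous
  rw [dist_eq_norm, dist_eq_norm]
  refine (norm_gradient_risk_sub_le hm h01 hf hL hs x y).trans ?_
  gcongr
  exact le_abs_self β

/-- One gradient step along an arbitrary direction `g`, with step size `a ≤ 1 / β`, decreases the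
risk up to the squared distance of `g` from the gradient of the risk. The inequality is pointwise:
`-⟪∇R, g⟫ + ‖g‖² / 2 = ‖g - ∇R‖² / 2 - ‖∇R‖² / 2` makes any conditioning on the past
superfluous. -/
lemma risk_sub_smul_le (hm : ∀ w, Measurable (f w)) (h01 : ∀ w z, f w z ∈ Set.Icc (0 : ℝ) 1)
    (hf : ∀ z, ContDiff ℝ 2 (fun w => f w z)) (hL : IsLipschitzLoss L f) (hs : IsSmoothLoss β f)
    {a : ℝ} (ha : 0 ≤ a) (haβ : a * β ≤ 1) (w g : EuclideanSpace ℝ (Fin d)) :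
    risk D f (w - a • g) ≤ risk D f w - a / 2 * ‖gradient (risk D f) w‖ ^ 2
      + a / 2 * ‖g - gradient (risk D f) w‖ ^ 2 := by
  have h := le_add_inner_add_sq_of_lipschitz_gradient (F := risk D f) (g := gradient (risk D f))
    (fun x => by rw [gradient_risk hm h01 hf hL]; exact hasGradientAt_risk hm h01 hf hL x)
    (norm_gradient_risk_sub_le hm h01 hf hL hs) w (w - a • g)
  rw [sub_sub_cancel_left, norm_neg, norm_smul, inner_neg_right, inner_smul_right,
    Real.norm_eq_abs, abs_of_nonneg ha] at h
  have h2 : ‖g - gradient (risk D f) w‖ ^ 2 = ‖g‖ ^ 2 - 2 * inner ℝ (gradient (risk D f) w) g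
      + ‖gradient (risk D f) w‖ ^ 2 := by
    rw [norm_sub_sq_real, real_inner_comm]
  rw [h2]
  nlinarith [mul_le_mul_of_nonneg_right haβ (mul_nonneg ha (sq_nonneg ‖g‖))]

end Loss

/-! ### Symmetries of the sample and the structure of the iterates -/

section Sample

variable {Z : Type*} [MeasurableSpace Z] {m : ℕ}

instance (D : Measure Z) [IsProbabilityMeasure D] : IsProbabilityMeasure (sampleLaw D m) := by
  unfold sampleLaw; infer_instance

/-- Exchange of the `k`-th example of a training set with an additional example. -/
def exchangeExample (k : Fin m) : ((Fin m → Z) × Z) ≃ᵐ ((Fin m → Z) × Z) where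
  toFun p := (Function.update p.1 k p.2, p.1 k)
  invFun p := (Function.update p.1 k p.2, p.1 k)
  left_inv p := by simp
  right_inv p := by simp
  measurable_toFun := by
    refine Measurable.prodMk (measurable_pi_iff.2 fun j => ?_) (by fun_prop)
    by_cases h : j = k
    · subst h; simpa using measurable_snd
    · simp only [Function.update_of_ne h]; fun_prop
  measurable_invFun := by
    refine Measurable.prodMk (measurable_pi_iff.2 fun j => ?_) (by fun_prop)
    by_cases h : j = k
    · subst h; simpa using measurable_snd
    · simp only [Function.update_of_ne h]; fun_prop

lemma exchangeExample_apply (k : Fin m) (p : (Fin m → Z) × Z) :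
    exchangeExample k p = (Function.update p.1 k p.2, p.1 k) := rfl

variable {D : Measure Z} [IsProbabilityMeasure D]

lemma measurePreserving_exchangeExample (k : Fin m) :
    MeasurePreserving (exchangeExample k) ((sampleLaw D m).prod D) ((sampleLaw D m).prod D) := by
  refine ⟨(exchangeExample k).measurable, ?_⟩
  have hgen : Set.univ.pi '' Set.univ.pi (fun _ : Fin m => {s : Set Z | MeasurableSet s})
      = {t | ∃ s : Fin m → Set Z, (∀ i, MeasurableSet (s i)) ∧ Set.univ.pi s = t} := by
    ext t; simp [Set.mem_pi]
  symm
  refine Measure.prod_eq_generateFrom (C := Set.univ.pi '' Set.univ.pi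
    (fun _ : Fin m => {s : Set Z | MeasurableSet s})) (D := {s : Set Z | MeasurableSet s})
    generateFrom_pi MeasurableSpace.generateFrom_measurableSet isPiSystem_pi
    MeasurableSpace.isPiSystem_measurableSet
    ⟨fun _ => Set.univ, fun _ => ?_, fun _ => measure_lt_top _ _, Set.iUnion_const _⟩
    (Measure.toFiniteSpanningSetsIn D) ?_
  · rw [hgen]
    exact ⟨fun _ => Set.univ, fun _ => MeasurableSet.univ, by simp⟩
  · rw [hgen]
    rintro _ ⟨s, hs, rfl⟩ u hu
    have hu : MeasurableSet u := hu
    rw [Measure.map_apply (exchangeExample k).measurable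
      ((MeasurableSet.univ_pi hs).prod hu)]
    have hpre : exchangeExample k ⁻¹' (Set.univ.pi s ×ˢ u)
        = Set.univ.pi (Function.update s k u) ×ˢ s k := by
      ext p
      simp only [Set.mem_preimage, exchangeExample_apply, Set.mem_prod, Set.mem_univ_pi]
      constructor
      · rintro ⟨h1, h2⟩
        refine ⟨fun j => ?_, by simpa using h1 k⟩
        by_cases h : j = k
        · subst h; simpa using h2
        · simpa [Function.update_of_ne h] using h1 j
      · rintro ⟨h1, h2⟩
        refine ⟨fun j => ?_, by simpa using h1 k⟩
        by_cases h : j = k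
        · subst h; simpa using h2
        · simpa [Function.update_of_ne h] using h1 j
    rw [hpre, Measure.prod_prod, sampleLaw, Measure.pi_pi, Measure.pi_pi,
      ← Finset.mul_prod_erase _ _ (Finset.mem_univ k),
      ← Finset.mul_prod_erase _ (fun i => D (s i)) (Finset.mem_univ k), Function.update_self]
    have : ∏ x ∈ Finset.univ.erase k, D (Function.update s k u x)
        = ∏ x ∈ Finset.univ.erase k, D (s x) :=
      Finset.prod_congr rfl fun x hx => by rw [Function.update_of_ne (Finset.ne_of_mem_erase hx)]
    rw [this]
    ring

/-- Reordering of a training set. -/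
def reorder (π : Equiv.Perm (Fin m)) : (Fin m → Z) ≃ᵐ (Fin m → Z) :=
  MeasurableEquiv.piCongrLeft (fun _ => Z) π.symm

lemma reorder_apply (π : Equiv.Perm (Fin m)) (S : Fin m → Z) : reorder π S = S ∘ π := by
  ext j
  obtain ⟨i, rfl⟩ := π.symm.surjective j
  rw [reorder, MeasurableEquiv.coe_piCongrLeft, Equiv.piCongrLeft_apply_apply]
  simp

lemma measurePreserving_reorder (π : Equiv.Perm (Fin m)) :
    MeasurePreserving (reorder (Z := Z) π) (sampleLaw D m) (sampleLaw D m) :=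
  measurePreserving_piCongrLeft (fun _ => D) π.symm

lemma integral_comp_perm (π : Equiv.Perm (Fin m)) (F : (Fin m → Z) → ℝ) :
    ∫ S, F (S ∘ π) ∂(sampleLaw D m) = ∫ S, F S ∂(sampleLaw D m) := by
  simpa only [reorder_apply] using
    (measurePreserving_reorder (D := D) π).integral_comp (reorder π).measurableEmbedding F

lemma integral_prod_comp_perm (π : Equiv.Perm (Fin m)) (F : (Fin m → Z) × Z → ℝ) :
    ∫ p : (Fin m → Z) × Z, F (p.1 ∘ π, p.2) ∂((sampleLaw D m).prod D)
      = ∫ p, F p ∂((sampleLaw D m).prod D) := by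
  have h := ((measurePreserving_reorder (D := D) π).prod (MeasurePreserving.id D)).integral_comp
    ((reorder π).prodCongr (MeasurableEquiv.refl Z)).measurableEmbedding F
  simpa [Prod.map, reorder_apply] using h

lemma integral_exchange (k : Fin m) (F : (Fin m → Z) × Z → ℝ) :
    ∫ p : (Fin m → Z) × Z, F (Function.update p.1 k p.2, p.1 k) ∂((sampleLaw D m).prod D)
      = ∫ p, F p ∂((sampleLaw D m).prod D) :=
  (measurePreserving_exchangeExample (D := D) k).integral_comp
    (exchangeExample k).measurableEmbedding F

end Sample

/-- Under a uniformly random permutation, the preimage of a fixed index is uniform. -/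
lemma expect_perm_symm_apply {m : ℕ} (G : Fin m → ℝ) (i : Fin m) :
    𝔼 π : Equiv.Perm (Fin m), G (π.symm i) = (∑ k, G k) / m := by
  have hm : Nonempty (Fin m) := ⟨i⟩
  have h1 : ∀ j, 𝔼 π : Equiv.Perm (Fin m), G (π.symm j)
      = 𝔼 π : Equiv.Perm (Fin m), G (π.symm i) := fun j => by
    refine Fintype.expect_equiv (Equiv.mulLeft (Equiv.swap i j)) _ _ fun π => ?_
    congr 1
    simp [Equiv.Perm.mul_def]
  have h2 : ∀ π : Equiv.Perm (Fin m), 𝔼 j, G (π.symm j) = 𝔼 k, G k := fun π =>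
    Fintype.expect_equiv π.symm _ _ fun _ => rfl
  calc 𝔼 π : Equiv.Perm (Fin m), G (π.symm i)
      = 𝔼 j, 𝔼 π : Equiv.Perm (Fin m), G (π.symm j) := by simp_rw [h1, Fintype.expect_const]
    _ = 𝔼 π : Equiv.Perm (Fin m), 𝔼 j, G (π.symm j) := Finset.expect_comm _ _ _
    _ = 𝔼 k, G k := by simp_rw [h2, Fintype.expect_const]
    _ = (∑ k, G k) / m := by rw [Fintype.expect_eq_sum_div_card, Fintype.card_fin]

section Iterates

variable {d m : ℕ} {Z : Type*} {f : EuclideanSpace ℝ (Fin d) → Z → ℝ} {α : ℕ → ℝ}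
  {w₁ : EuclideanSpace ℝ (Fin d)}

/-- The iterates depend on the training set and on the order only through the reordered training
set. -/
lemma sgdAfter_eq_comp_perm (S : Fin m → Z) (π : Equiv.Perm (Fin m)) (n : ℕ) :
    sgdAfter f α w₁ S π n = sgdAfter f α w₁ (S ∘ π) 1 n := by
  induction n with
  | zero => rfl
  | succ n ih => simp only [sgdAfter, ih]; rfl

/-- The stochastic gradient of the update number `s + 1`, for the natural order of the examples; it
is zero once the training set is exhausted. -/
noncomputable def sgdDirection (f : EuclideanSpace ℝ (Fin d) → Z → ℝ) (α : ℕ → ℝ)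
    (w₁ : EuclideanSpace ℝ (Fin d)) (S : Fin m → Z) (s : ℕ) : EuclideanSpace ℝ (Fin d) :=
  if h : s < m then lossGrad f (sgdAfter f α w₁ S 1 s) (S ⟨s, h⟩) else 0

lemma sgdAfter_succ (S : Fin m → Z) (s : ℕ) :
    sgdAfter f α w₁ S 1 (s + 1)
      = sgdAfter f α w₁ S 1 s - α (s + 1) • sgdDirection f α w₁ S s := by
  by_cases h : s < m <;> simp [sgdAfter, sgdDirection, h]

/-- An example influences only the iterates that follow its update. -/
lemma sgdAfter_update_of_le (S : Fin m → Z) (z : Z) (k : Fin m) {n : ℕ} (hn : n ≤ k) :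
    sgdAfter f α w₁ (Function.update S k z) 1 n = sgdAfter f α w₁ S 1 n := by
  induction n with
  | zero => rfl
  | succ n ih =>
    rw [sgdAfter_succ, sgdAfter_succ, sgdDirection, sgdDirection, ih (by omega)]
    by_cases h : n < m
    · have : (⟨n, h⟩ : Fin m) ≠ k := fun e => by rw [← e] at hn; simp at hn
      simp [h, Function.update_of_ne this]
    · simp [h]

lemma norm_sgdDirection_le {L : ℝ} (hL0 : 0 ≤ L) (hL : IsLipschitzLoss L f) (S : Fin m → Z)
    (s : ℕ) : ‖sgdDirection f α w₁ S s‖ ≤ L := by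
  rw [sgdDirection]
  split_ifs
  · exact hL _ _
  · simpa using hL0

lemma norm_sgdAfter_sub_le {L : ℝ} (hL0 : 0 ≤ L) (hL : IsLipschitzLoss L f) (S : Fin m → Z)
    (n : ℕ) : ‖sgdAfter f α w₁ S 1 n - w₁‖ ≤ ∑ s ∈ Finset.range n, |α (s + 1)| * L := by
  induction n with
  | zero => simp [sgdAfter]
  | succ n ih =>
    rw [sgdAfter_succ, Finset.sum_range_succ, sub_right_comm]
    refine (norm_sub_le _ _).trans (add_le_add ih ?_)
    rw [norm_smul, Real.norm_eq_abs]
    gcongr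
    exact norm_sgdDirection_le hL0 hL S n

variable [MeasurableSpace Z]

lemma measurable_sgdAfter (hm : ∀ w, Measurable (f w)) (hf : ∀ z, ContDiff ℝ 2 (fun w => f w z))
    (n : ℕ) : Measurable fun S : Fin m → Z => sgdAfter f α w₁ S 1 n := by
  induction n with
  | zero => exact measurable_const
  | succ n ih =>
    by_cases h : n < m
    · have h2 := (measurable_lossGrad_uncurry hm hf).comp
        (ih.prodMk (measurable_pi_apply (⟨n, h⟩ : Fin m)))
      have h3 := ih.sub (h2.const_smul (α (n + 1)))
      simp only [sgdAfter, h, dif_pos]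
      exact h3
    · simpa [sgdAfter, h] using ih

lemma measurable_sgdDirection (hm : ∀ w, Measurable (f w))
    (hf : ∀ z, ContDiff ℝ 2 (fun w => f w z)) (s : ℕ) :
    Measurable fun S : Fin m → Z => sgdDirection f α w₁ S s := by
  by_cases h : s < m
  · have h2 := (measurable_lossGrad_uncurry hm hf).comp
        ((measurable_sgdAfter (α := α) (w₁ := w₁) hm hf s).prodMk
          (measurable_pi_apply (⟨s, h⟩ : Fin m)))
    simp only [sgdDirection, h, dif_pos]
    exact h2
  · simp [sgdDirection, h]

variable {D : Measure Z} [IsProbabilityMeasure D]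

/-- The example of the next update is as good as a fresh example. -/
lemma integral_sgdDirection {s : ℕ} (hs : s < m)
    (F : EuclideanSpace ℝ (Fin d) → EuclideanSpace ℝ (Fin d) → ℝ) :
    ∫ p : (Fin m → Z) × Z, F (sgdAfter f α w₁ p.1 1 s) (sgdDirection f α w₁ p.1 s)
        ∂((sampleLaw D m).prod D)
      = ∫ p : (Fin m → Z) × Z, F (sgdAfter f α w₁ p.1 1 s)
        (lossGrad f (sgdAfter f α w₁ p.1 1 s) p.2) ∂((sampleLaw D m).prod D) := by
  rw [← integral_exchange ⟨s, hs⟩ (D := D) fun p : (Fin m → Z) × Z => F (sgdAfter f α w₁ p.1 1 s)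
        (lossGrad f (sgdAfter f α w₁ p.1 1 s) p.2)]
  refine integral_congr_ae (Filter.Eventually.of_forall fun p => ?_)
  simp only [sgdDirection, hs, dif_pos]
  rw [sgdAfter_update_of_le _ _ _ (le_refl s)]

end Iterates

/-! ### The distance travelled by the iterates -/

section Travel

variable {d m T : ℕ} {Z : Type*} [MeasurableSpace Z] {D : Measure Z} [IsProbabilityMeasure D]
  {f : EuclideanSpace ℝ (Fin d) → Z → ℝ} {w₁ : EuclideanSpace ℝ (Fin d)} {L β ρ σ c : ℝ}

/-- The standing assumptions on the loss: values in `[0, 1]`, measurability in the example, and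
Lipschitz bounds on the loss, its gradient and its Hessian, with admissible constants. -/
structure IsRegularLoss (f : EuclideanSpace ℝ (Fin d) → Z → ℝ) (L β ρ : ℝ) : Prop where
  meas : ∀ w, Measurable (f w)
  mem_Icc : ∀ w z, f w z ∈ Set.Icc (0 : ℝ) 1
  contDiff : ∀ z, ContDiff ℝ 2 (fun w => f w z)
  lipschitz : IsLipschitzLoss L f
  smooth : IsSmoothLoss β f
  lipschitzHessian : HasLipschitzHessian ρ f
  lipschitz_nonneg : 0 ≤ L
  smooth_pos : 0 < β
  lipschitzHessian_nonneg : 0 ≤ ρ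

/-- The squared distance travelled by inexact gradient descent on the risk is controlled by the
initial suboptimality and the squared errors of the directions. -/
lemma IsRegularLoss.norm_sub_sq_le (hf : IsRegularLoss f L β ρ)
    {w g : ℕ → EuclideanSpace ℝ (Fin d)} {a : ℕ → ℝ} (ha : ∀ s, 0 ≤ a s) (haβ : ∀ s, a s * β ≤ 1)
    (hw : ∀ s, w (s + 1) = w s - a s • g s) (n : ℕ) :
    ‖w n - w 0‖ ^ 2 ≤ 4 * (∑ s ∈ Finset.range n, a s) * ((risk D f (w 0) - ⨅ v, risk D f v)
      + ∑ s ∈ Finset.range n, a s * ‖g s - gradient (risk D f) (w s)‖ ^ 2) := by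
  have h1 : ∑ s ∈ Finset.range n, a s * ‖gradient (risk D f) (w s)‖ ^ 2
      ≤ 2 * (risk D f (w 0) - risk D f (w n))
        + ∑ s ∈ Finset.range n, a s * ‖g s - gradient (risk D f) (w s)‖ ^ 2 := by
    induction n with
    | zero => simp
    | succ n ih =>
      rw [Finset.sum_range_succ, Finset.sum_range_succ]
      have h := risk_sub_smul_le (D := D) hf.meas hf.mem_Icc hf.contDiff hf.lipschitz hf.smooth
        (ha n) (haβ n) (w n) (g n)
      rw [← hw] at h
      linarith
  have h2 : ‖w n - w 0‖ ≤ ∑ s ∈ Finset.range n, a s * ‖g s‖ := by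
    clear h1
    induction n with
    | zero => simp
    | succ n ih =>
      rw [hw, Finset.sum_range_succ, sub_right_comm]
      refine (norm_sub_le _ _).trans (add_le_add ih ?_)
      rw [norm_smul, Real.norm_eq_abs, abs_of_nonneg (ha n)]
  have h3 : (∑ s ∈ Finset.range n, a s * ‖g s‖) ^ 2
      ≤ (∑ s ∈ Finset.range n, a s) * ∑ s ∈ Finset.range n, a s * ‖g s‖ ^ 2 :=
    Finset.sum_sq_le_sum_mul_sum_of_sq_le_mul _ (fun s _ => ha s)
      (fun s _ => mul_nonneg (ha s) (sq_nonneg _)) (fun s _ => le_of_eq (by ring))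
  have h4 : ∑ s ∈ Finset.range n, a s * ‖g s‖ ^ 2
      ≤ 2 * ∑ s ∈ Finset.range n, a s * ‖gradient (risk D f) (w s)‖ ^ 2
        + 2 * ∑ s ∈ Finset.range n, a s * ‖g s - gradient (risk D f) (w s)‖ ^ 2 := by
    rw [Finset.mul_sum, Finset.mul_sum, ← Finset.sum_add_distrib]
    refine Finset.sum_le_sum fun s _ => ?_
    have h := norm_le_norm_add_norm_sub' (g s) (gradient (risk D f) (w s))
    have h' : ‖g s‖ ^ 2 ≤ 2 * ‖gradient (risk D f) (w s)‖ ^ 2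
        + 2 * ‖g s - gradient (risk D f) (w s)‖ ^ 2 := by
      nlinarith [norm_nonneg (g s), sq_nonneg (‖gradient (risk D f) (w s)‖
        - ‖g s - gradient (risk D f) (w s)‖)]
    nlinarith [mul_le_mul_of_nonneg_left h' (ha s)]
  have h5 := iInf_risk_le (D := D) hf.mem_Icc (w n)
  have h6 : (0 : ℝ) ≤ ∑ s ∈ Finset.range n, a s := Finset.sum_nonneg fun s _ => ha s
  calc ‖w n - w 0‖ ^ 2 ≤ (∑ s ∈ Finset.range n, a s * ‖g s‖) ^ 2 := by gcongr
    _ ≤ (∑ s ∈ Finset.range n, a s) * ∑ s ∈ Finset.range n, a s * ‖g s‖ ^ 2 := h3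
    _ ≤ (∑ s ∈ Finset.range n, a s) * (4 * ((risk D f (w 0) - ⨅ v, risk D f v)
      + ∑ s ∈ Finset.range n, a s * ‖g s - gradient (risk D f) (w s)‖ ^ 2)) := by
        gcongr
        linarith
    _ = _ := by ring

lemma sum_inv_le_one_add_log {n : ℕ} (hn : n ≤ T) :
    ∑ s ∈ Finset.range n, 1 / ((s + 1 : ℕ) : ℝ) ≤ 1 + Real.log T := by
  have h := harmonic_le_one_add_log T
  rw [harmonic] at h
  push_cast at h
  refine le_trans ?_ h
  refine (Finset.sum_le_sum_of_subset_of_nonneg (Finset.range_mono hn)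
    fun _ _ _ => by positivity).trans_eq (Finset.sum_congr rfl fun s _ => by simp)

lemma sq_integral_le {Ω : Type*} [MeasurableSpace Ω] {P : Measure Ω} [IsProbabilityMeasure P]
    {X : Ω → ℝ} (hX : Integrable X P) (hX2 : Integrable (fun ω => X ω ^ 2) P) :
    (∫ ω, X ω ∂P) ^ 2 ≤ ∫ ω, X ω ^ 2 ∂P :=
  (even_two.convexOn_pow (𝕜 := ℝ)).map_integral_le (by fun_prop) isClosed_univ
    (Filter.Eventually.of_forall fun _ => Set.mem_univ _) hX hX2

/-- The bound `σ²` on the variance of the stochastic gradients along the iterates, for the natural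
order of the examples. -/
def HasGradientVariance (D : Measure Z) (f : EuclideanSpace ℝ (Fin d) → Z → ℝ) (α : ℕ → ℝ)
    (w₁ : EuclideanSpace ℝ (Fin d)) (m T : ℕ) (σ : ℝ) : Prop :=
  ∀ s < T, ∫ p : (Fin m → Z) × Z, ‖lossGrad f (sgdAfter f α w₁ p.1 1 s) p.2
    - gradient (risk D f) (sgdAfter f α w₁ p.1 1 s)‖ ^ 2 ∂((sampleLaw D m).prod D) ≤ σ ^ 2

lemma IsRegularLoss.integrable_norm_sgdAfter_sub (hf : IsRegularLoss f L β ρ) {α : ℕ → ℝ} (n : ℕ) :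
    Integrable (fun p : (Fin m → Z) × Z => ‖sgdAfter f α w₁ p.1 1 n - w₁‖)
      ((sampleLaw D m).prod D) :=
  Integrable.of_bound ((((measurable_sgdAfter hf.meas hf.contDiff n).comp
    measurable_fst).sub_const w₁).norm).aestronglyMeasurable _
    (Filter.Eventually.of_forall fun p => by
      simpa using norm_sgdAfter_sub_le hf.lipschitz_nonneg hf.lipschitz p.1 n)

/-- The expected distance travelled by SGD. The examples of the updates being fresh, the directions
have the variance of the stochastic gradients, and `IsRegularLoss.norm_sub_sq_le` applies with total
step size at most `c (1 + log T)`. -/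
lemma IsRegularLoss.integral_norm_sgdAfter_sub_le (hf : IsRegularLoss f L β ρ)
    (hT : 1 ≤ T) (hTm : T ≤ m) (hσ : 0 ≤ σ) (hc : 0 < c) (hcβ : c * β ≤ 1)
    (hvar : HasGradientVariance D f (fun t => c / t) w₁ m T σ) {n : ℕ} (hn : n ≤ T) :
    ∫ p : (Fin m → Z) × Z, ‖sgdAfter f (fun t => c / t) w₁ p.1 1 n - w₁‖ ∂((sampleLaw D m).prod D)
      ≤ 2 * (1 + Real.log T) * (c * σ + Real.sqrt (c * (risk D f w₁ - ⨅ w, risk D f w))) := by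
  set P := (sampleLaw D m).prod D
  set Λ := 1 + Real.log T
  set Δ := risk D f w₁ - ⨅ w, risk D f w
  have hΛ : 1 ≤ Λ := by
    have := Real.log_nonneg (Nat.one_le_cast.2 hT : (1 : ℝ) ≤ T)
    simp only [Λ]; linarith
  have hΔ : 0 ≤ Δ := sub_nonneg.2 (iInf_risk_le hf.mem_Icc w₁)
  let a : ℕ → ℝ := fun s => c / ((s + 1 : ℕ) : ℝ)
  have ha : ∀ s, 0 ≤ a s := fun s => by positivity
  have haβ : ∀ s, a s * β ≤ 1 := fun s => by
    refine le_trans (mul_le_mul_of_nonneg_right ?_ hf.smooth_pos.le) hcβ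
    exact div_le_self hc.le (by simp)
  have hA0 : 0 ≤ ∑ s ∈ Finset.range n, a s := Finset.sum_nonneg fun s _ => ha s
  have hA : ∑ s ∈ Finset.range n, a s ≤ c * Λ := by
    refine le_trans (le_of_eq ?_) (mul_le_mul_of_nonneg_left (sum_inv_le_one_add_log hn) hc.le)
    rw [Finset.mul_sum]
    exact Finset.sum_congr rfl fun s _ => by simp only [a]; ring
  let b : ℕ → (Fin m → Z) × Z → ℝ := fun s p =>
    ‖sgdDirection f (fun t => c / t) w₁ p.1 s
      - gradient (risk D f) (sgdAfter f (fun t => c / t) w₁ p.1 1 s)‖ ^ 2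
  have hbm : ∀ s, Measurable (b s) := fun s =>
    ((((measurable_sgdDirection hf.meas hf.contDiff s).comp measurable_fst).sub
      ((continuous_gradient_risk hf.meas hf.mem_Icc hf.contDiff hf.lipschitz
        hf.smooth).measurable.comp
        ((measurable_sgdAfter hf.meas hf.contDiff s).comp measurable_fst))).norm).pow_const 2
  have hbi : ∀ s, Integrable (b s) P := fun s =>
    Integrable.of_bound (hbm s).aestronglyMeasurable ((L + L) ^ 2)
      (Filter.Eventually.of_forall fun p => by
        simp only [b]
        rw [norm_pow, norm_norm]
        gcongr
        refine (norm_sub_le _ _).trans (add_le_add ?_ ?_)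
        · exact norm_sgdDirection_le hf.lipschitz_nonneg hf.lipschitz _ _
        · exact norm_gradient_risk_le hf.meas hf.mem_Icc hf.contDiff hf.lipschitz _)
  have hb : ∀ s ∈ Finset.range n, ∫ p, b s p ∂P ≤ σ ^ 2 := fun s hs => by
    have hs := Finset.mem_range.1 hs
    refine le_trans (le_of_eq ?_) (hvar s (by omega))
    exact integral_sgdDirection (by omega) fun w g => ‖g - gradient (risk D f) w‖ ^ 2
  -- Pointwise in the sample; no independence is used here.
  have hpt : ∀ p : (Fin m → Z) × Z, ‖sgdAfter f (fun t => c / t) w₁ p.1 1 n - w₁‖ ^ 2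
      ≤ 4 * (∑ s ∈ Finset.range n, a s) * (Δ + ∑ s ∈ Finset.range n, a s * b s p) := fun p =>
    hf.norm_sub_sq_le (D := D) (w := fun s => sgdAfter f (fun t => c / t) w₁ p.1 1 s)
      ha haβ (fun s => sgdAfter_succ p.1 s) n
  have hsumi : Integrable (fun p => ∑ s ∈ Finset.range n, a s * b s p) P :=
    integrable_finsetSum _ fun s _ => (hbi s).const_mul (a s)
  have hsum : ∫ p, ∑ s ∈ Finset.range n, a s * b s p ∂P ≤ (∑ s ∈ Finset.range n, a s) * σ ^ 2 := by
    rw [integral_finsetSum _ fun s _ => (hbi s).const_mul (a s), Finset.sum_mul]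
    refine Finset.sum_le_sum fun s hs => ?_
    rw [integral_const_mul]
    exact mul_le_mul_of_nonneg_left (hb s hs) (ha s)
  have hni := hf.integrable_norm_sgdAfter_sub (D := D) (m := m) (w₁ := w₁)
    (α := fun t => c / t) n
  have hrhs : Integrable (fun p => 4 * (∑ s ∈ Finset.range n, a s)
      * (Δ + ∑ s ∈ Finset.range n, a s * b s p)) P :=
    ((integrable_const Δ).add hsumi).const_mul _
  have hn2i : Integrable (fun p : (Fin m → Z) × Z =>
      ‖sgdAfter f (fun t => c / t) w₁ p.1 1 n - w₁‖ ^ 2) P :=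
    hrhs.mono' (hni.aestronglyMeasurable.pow 2) (Filter.Eventually.of_forall fun p => by
      rw [norm_pow, norm_norm]; exact hpt p)
  have hsq : (∫ p : (Fin m → Z) × Z, ‖sgdAfter f (fun t => c / t) w₁ p.1 1 n - w₁‖ ∂P) ^ 2
      ≤ 4 * (c * Λ) * (Δ + c * Λ * σ ^ 2) := by
    refine (sq_integral_le hni hn2i).trans ((integral_mono hn2i hrhs hpt).trans ?_)
    rw [integral_const_mul, integral_add (integrable_const Δ) hsumi, integral_const]
    simp only [probReal_univ, one_smul]
    have h1 : (∑ s ∈ Finset.range n, a s) * σ ^ 2 ≤ c * Λ * σ ^ 2 := by gcongr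
    have h2 : 0 ≤ Δ + ∫ p, ∑ s ∈ Finset.range n, a s * b s p ∂P :=
      add_nonneg hΔ (integral_nonneg fun p => Finset.sum_nonneg fun s _ =>
        mul_nonneg (ha s) (sq_nonneg _))
    refine mul_le_mul (by linarith) (by linarith) h2 (by positivity)
  refine le_of_sq_le_sq (hsq.trans ?_) (by positivity)
  have h1 := Real.sq_sqrt (mul_nonneg hc.le hΔ)
  have h2 := Real.sqrt_nonneg (c * Δ)
  -- `Λ ≤ Λ ^ 2` because `1 ≤ Λ`.
  have h3 : c * Λ * Δ ≤ Λ ^ 2 * (c * Δ) := by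
    nlinarith [mul_nonneg (mul_nonneg hc.le hΔ) (mul_nonneg (by linarith : (0:ℝ) ≤ Λ)
      (sub_nonneg.2 hΛ))]
  have h4 : 0 ≤ Λ ^ 2 * (c * σ * Real.sqrt (c * Δ)) := by positivity
  calc 4 * (c * Λ) * (Δ + c * Λ * σ ^ 2) = 4 * (c * Λ * Δ) + 4 * (Λ ^ 2 * (c * σ) ^ 2) := by ring
    _ ≤ 4 * (Λ ^ 2 * Real.sqrt (c * Δ) ^ 2) + 4 * (Λ ^ 2 * (c * σ) ^ 2) := by rw [h1]; linarith
    _ ≤ (2 * Λ * (c * σ + Real.sqrt (c * Δ))) ^ 2 := by nlinarith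

end Travel

/-! ### Divergence of two coupled runs -/

section Divergence

variable {d m T : ℕ} {Z : Type*} [MeasurableSpace Z] {D : Measure Z} [IsProbabilityMeasure D]
  {f : EuclideanSpace ℝ (Fin d) → Z → ℝ} {w₁ : EuclideanSpace ℝ (Fin d)} {α : ℕ → ℝ}
  {L β ρ σ c γ : ℝ}

/-- A bound on the curvature of the loss between the iterates number `s` of the runs on `p.1` and on
`p.1` with its `k`-th example replaced by `p.2`, at the example of the next update: the smoothness
`β`, or the Hessian at `w₁` plus `ρ` times the distances travelled, whichever is smaller. -/
noncomputable def pathCurvature (f : EuclideanSpace ℝ (Fin d) → Z → ℝ) (β ρ : ℝ) (α : ℕ → ℝ)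
    (w₁ : EuclideanSpace ℝ (Fin d)) (k : Fin m) (s : ℕ) (p : (Fin m → Z) × Z) : ℝ :=
  min β ((if h : s < m then ‖lossHess f w₁ (p.1 ⟨s, h⟩)‖ else 0)
    + ρ * (‖sgdAfter f α w₁ p.1 1 s - w₁‖
      + ‖sgdAfter f α w₁ (Function.update p.1 k p.2) 1 s - w₁‖))

/-- The distance between the parameters of the runs on `p.1` and on `p.1` with its `k`-th example
replaced by `p.2`, after `n` updates. -/
noncomputable def divergence (f : EuclideanSpace ℝ (Fin d) → Z → ℝ) (α : ℕ → ℝ)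
    (w₁ : EuclideanSpace ℝ (Fin d)) (k : Fin m) (n : ℕ) (p : (Fin m → Z) × Z) : ℝ :=
  ‖sgdAfter f α w₁ p.1 1 n - sgdAfter f α w₁ (Function.update p.1 k p.2) 1 n‖

lemma IsRegularLoss.pathCurvature_nonneg (hf : IsRegularLoss f L β ρ) (k : Fin m) (s : ℕ)
    (p : (Fin m → Z) × Z) : 0 ≤ pathCurvature f β ρ α w₁ k s p := by
  have h1 := hf.smooth_pos
  have h2 := hf.lipschitzHessian_nonneg
  refine le_min h1.le (add_nonneg ?_ (by positivity))
  split_ifs <;> positivity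

lemma measurable_replaceExample (k : Fin m) :
    Measurable fun p : (Fin m → Z) × Z => Function.update p.1 k p.2 :=
  measurable_fst.comp (exchangeExample k).measurable

lemma IsRegularLoss.measurable_pathCurvature (hf : IsRegularLoss f L β ρ) (k : Fin m) (s : ℕ) :
    Measurable (pathCurvature f β ρ α w₁ k s) := by
  have h1 := ((measurable_sgdAfter (α := α) (w₁ := w₁) hf.meas hf.contDiff s).comp
    (measurable_fst : Measurable (Prod.fst : (Fin m → Z) × Z → Fin m → Z))).sub_const w₁
  have h2 := ((measurable_sgdAfter (α := α) (w₁ := w₁) hf.meas hf.contDiff s).comp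
    (measurable_replaceExample (Z := Z) k)).sub_const w₁
  refine measurable_const.min (Measurable.add ?_ ((h1.norm.add h2.norm).const_mul ρ))
  by_cases h : s < m
  · simp only [h, dif_pos]
    exact (measurable_norm_lossHess hf.meas hf.contDiff w₁).comp
      ((measurable_pi_apply (⟨s, h⟩ : Fin m)).comp measurable_fst)
  · simp [h]

lemma IsRegularLoss.measurable_divergence (hf : IsRegularLoss f L β ρ) (k : Fin m) (n : ℕ) :
    Measurable (divergence f α w₁ k n) :=
  (((measurable_sgdAfter hf.meas hf.contDiff n).comp measurable_fst).sub
    ((measurable_sgdAfter hf.meas hf.contDiff n).comp (measurable_replaceExample k))).norm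

/-- The two runs coincide up to their first different update. -/
lemma IsRegularLoss.divergence_succ_self_le (hf : IsRegularLoss f L β ρ) (hα : ∀ t, 0 ≤ α t)
    (k : Fin m) (p : (Fin m → Z) × Z) :
    divergence f α w₁ k (k + 1) p ≤ α (k + 1) * (2 * L) := by
  rw [divergence, sgdAfter_succ, sgdAfter_succ, sgdAfter_update_of_le _ _ _ le_rfl,
    sub_sub_sub_cancel_left, ← smul_sub, norm_smul, Real.norm_eq_abs, abs_of_nonneg (hα _)]
  refine mul_le_mul_of_nonneg_left ((norm_sub_le _ _).trans ?_) (hα _)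
  rw [two_mul]
  exact add_le_add (norm_sgdDirection_le hf.lipschitz_nonneg hf.lipschitz _ _)
    (norm_sgdDirection_le hf.lipschitz_nonneg hf.lipschitz _ _)

/-- From then on, both runs see the same examples, and an update expands their distance by the
curvature of the loss. -/
lemma IsRegularLoss.divergence_succ_le (hf : IsRegularLoss f L β ρ) (hα : ∀ t, 0 ≤ α t)
    (k : Fin m) {s : ℕ} (hs : (k : ℕ) < s) (p : (Fin m → Z) × Z) :
    divergence f α w₁ k (s + 1) p
      ≤ (1 + α (s + 1) * pathCurvature f β ρ α w₁ k s p) * divergence f α w₁ k s p := by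
  have hg : ‖sgdDirection f α w₁ p.1 s - sgdDirection f α w₁ (Function.update p.1 k p.2) s‖
      ≤ pathCurvature f β ρ α w₁ k s p * divergence f α w₁ k s p := by
    by_cases h : s < m
    · have hne : (⟨s, h⟩ : Fin m) ≠ k := fun e => by rw [← e] at hs; simp at hs
      rw [pathCurvature, divergence, min_mul_of_nonneg _ _ (norm_nonneg _), sgdDirection,
        sgdDirection]
      simp only [h, dif_pos, Function.update_of_ne hne]
      exact le_min (hf.smooth _ _ _)
        (norm_lossGrad_sub_le hf.contDiff hf.lipschitzHessian_nonneg hf.lipschitzHessian _ _ _ _)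
    · rw [sgdDirection, sgdDirection]
      simp only [h, dif_neg, not_false_eq_true, sub_self, norm_zero]
      exact mul_nonneg (hf.pathCurvature_nonneg k s p) (norm_nonneg _)
  have heq : sgdAfter f α w₁ p.1 1 (s + 1) - sgdAfter f α w₁ (Function.update p.1 k p.2) 1 (s + 1)
      = (sgdAfter f α w₁ p.1 1 s - sgdAfter f α w₁ (Function.update p.1 k p.2) 1 s)
        - α (s + 1) • (sgdDirection f α w₁ p.1 s
          - sgdDirection f α w₁ (Function.update p.1 k p.2) s) := by
    rw [sgdAfter_succ, sgdAfter_succ, smul_sub]; abel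
  have h1 : divergence f α w₁ k (s + 1) p ≤ divergence f α w₁ k s p
      + α (s + 1) * ‖sgdDirection f α w₁ p.1 s
        - sgdDirection f α w₁ (Function.update p.1 k p.2) s‖ := by
    rw [divergence, heq]
    refine (norm_sub_le _ _).trans_eq ?_
    rw [norm_smul, Real.norm_eq_abs, abs_of_nonneg (hα _), divergence]
  have h2 := mul_le_mul_of_nonneg_left hg (hα (s + 1))
  linarith

lemma IsRegularLoss.divergence_le (hf : IsRegularLoss f L β ρ) (hα : ∀ t, 0 ≤ α t)
    (k : Fin m) {n : ℕ} (hn : (k : ℕ) + 1 ≤ n) (p : (Fin m → Z) × Z) :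
    divergence f α w₁ k n p ≤ α (k + 1) * (2 * L)
      * Real.exp (∑ s ∈ Finset.Ico ((k : ℕ) + 1) n,
        α (s + 1) * pathCurvature f β ρ α w₁ k s p) := by
  induction n, hn using Nat.le_induction with
  | base => simpa using hf.divergence_succ_self_le hα k p
  | succ n hn ih =>
    rw [Finset.sum_Ico_succ_top hn, Real.exp_add, ← mul_assoc]
    have h0 := mul_nonneg (hα (n + 1)) (hf.pathCurvature_nonneg (α := α) (w₁ := w₁) k n p)
    have h1 := hf.divergence_succ_le (w₁ := w₁) hα k (Nat.lt_of_succ_le hn) p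
    have h2 := Real.add_one_le_exp (α (n + 1) * pathCurvature f β ρ α w₁ k n p)
    rw [add_comm] at h2
    calc _ ≤ _ := h1
      _ ≤ Real.exp (α (n + 1) * pathCurvature f β ρ α w₁ k n p) * _ :=
        mul_le_mul h2 ih (norm_nonneg _) (Real.exp_pos _).le
      _ = _ := mul_comm _ _

lemma sum_Ico_inv_le_log {k n : ℕ} (hn : k + 1 ≤ n) :
    ∑ s ∈ Finset.Ico (k + 1) n, 1 / ((s + 1 : ℕ) : ℝ) ≤ Real.log (n / ((k + 1 : ℕ) : ℝ)) := by
  induction n, hn using Nat.le_induction with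
  | base => rw [div_self (by positivity)]; simp
  | succ n hn ih =>
    have hn0 : (0 : ℝ) < n := Nat.cast_pos.2 (by omega)
    have hk0 : (0 : ℝ) < ((k + 1 : ℕ) : ℝ) := by positivity
    have hn1 : (0 : ℝ) < ((n + 1 : ℕ) : ℝ) := by positivity
    rw [Finset.sum_Ico_succ_top hn]
    have h := Real.one_sub_inv_le_log_of_pos (div_pos hn1 hn0)
    have e : 1 - (((n + 1 : ℕ) : ℝ) / n)⁻¹ = 1 / ((n + 1 : ℕ) : ℝ) := by
      rw [inv_div]; push_cast; field_simp; ring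
    rw [e, Real.log_div hn1.ne' hn0.ne'] at h
    rw [Real.log_div hn0.ne' hk0.ne'] at ih
    rw [Real.log_div hn1.ne' hk0.ne']
    linarith

/-- The Hessian is evaluated at the fixed point `w₁`, so it enters with its mean under `D`; the two
runs have the same law, so both distances travelled have the same mean. -/
lemma IsRegularLoss.integral_pathCurvature_le (hf : IsRegularLoss f L β ρ) (k : Fin m) {s : ℕ}
    (hs : s < m) {M : ℝ}
    (hM : ∫ p : (Fin m → Z) × Z, ‖sgdAfter f α w₁ p.1 1 s - w₁‖ ∂((sampleLaw D m).prod D) ≤ M) :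
    ∫ p, pathCurvature f β ρ α w₁ k s p ∂((sampleLaw D m).prod D)
      ≤ ∫ z, ‖lossHess f w₁ z‖ ∂D + ρ * (2 * M) := by
  set P := (sampleLaw D m).prod D
  have hmp : MeasurePreserving (fun p : (Fin m → Z) × Z => p.1 ⟨s, hs⟩) P D :=
    (measurePreserving_eval (fun _ => D) _).comp measurePreserving_fst
  have hmeasH := measurable_norm_lossHess hf.meas hf.contDiff w₁
  have hH : Integrable (fun z => ‖lossHess f w₁ z‖) D :=
    Integrable.of_bound hmeasH.aestronglyMeasurable β (Filter.Eventually.of_forall fun z => by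
      rw [norm_norm]; exact norm_lossHess_le hf.smooth_pos.le hf.smooth w₁ z)
  have hHi : Integrable (fun p : (Fin m → Z) × Z => ‖lossHess f w₁ (p.1 ⟨s, hs⟩)‖) P :=
    hmp.integrable_comp_of_integrable hH
  have hHe : ∫ p : (Fin m → Z) × Z, ‖lossHess f w₁ (p.1 ⟨s, hs⟩)‖ ∂P
      = ∫ z, ‖lossHess f w₁ z‖ ∂D := by
    rw [← hmp.map_eq, integral_map hmp.measurable.aemeasurable hmeasH.aestronglyMeasurable]
  have h1 := hf.integrable_norm_sgdAfter_sub (D := D) (m := m) (w₁ := w₁) (α := α) s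
  have h2 : Integrable (fun p : (Fin m → Z) × Z =>
      ‖sgdAfter f α w₁ (Function.update p.1 k p.2) 1 s - w₁‖) P :=
    (measurePreserving_exchangeExample k).integrable_comp_of_integrable h1
  have h2e : ∫ p : (Fin m → Z) × Z, ‖sgdAfter f α w₁ (Function.update p.1 k p.2) 1 s - w₁‖ ∂P
      = ∫ p : (Fin m → Z) × Z, ‖sgdAfter f α w₁ p.1 1 s - w₁‖ ∂P :=
    integral_exchange k fun p => ‖sgdAfter f α w₁ p.1 1 s - w₁‖
  calc ∫ p, pathCurvature f β ρ α w₁ k s p ∂P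
      ≤ ∫ p : (Fin m → Z) × Z, (‖lossHess f w₁ (p.1 ⟨s, hs⟩)‖
          + ρ * (‖sgdAfter f α w₁ p.1 1 s - w₁‖
            + ‖sgdAfter f α w₁ (Function.update p.1 k p.2) 1 s - w₁‖)) ∂P := by
        refine integral_mono_of_nonneg
          (Filter.Eventually.of_forall fun p => hf.pathCurvature_nonneg k s p)
          (hHi.add ((h1.add h2).const_mul ρ)) (Filter.Eventually.of_forall fun p => ?_)
        refine (min_le_right _ _).trans_eq ?_
        simp [hs]
    _ = ∫ z, ‖lossHess f w₁ z‖ ∂D + ρ * (2 *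
          ∫ p : (Fin m → Z) × Z, ‖sgdAfter f α w₁ p.1 1 s - w₁‖ ∂P) := by
        have h12 : Integrable (fun p : (Fin m → Z) × Z => ‖sgdAfter f α w₁ p.1 1 s - w₁‖
            + ‖sgdAfter f α w₁ (Function.update p.1 k p.2) 1 s - w₁‖) P := h1.add h2
        rw [integral_add hHi (h12.const_mul ρ), integral_const_mul, integral_add h1 h2,
          h2e, hHe, two_mul]
    _ ≤ _ := by
        have := hf.lipschitzHessian_nonneg
        gcongr

/-- The exponential of a variable in `[0, 1]` has an expectation of at most `exp (2 E X)`. -/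
lemma integral_exp_le {Ω : Type*} [MeasurableSpace Ω] {P : Measure Ω} [IsProbabilityMeasure P]
    {X : Ω → ℝ} (hX : Measurable X) (h0 : ∀ ω, 0 ≤ X ω) (h1 : ∀ ω, X ω ≤ 1) :
    ∫ ω, Real.exp (X ω) ∂P ≤ Real.exp (2 * ∫ ω, X ω ∂P) := by
  have hi : Integrable X P := Integrable.of_bound hX.aestronglyMeasurable 1
    (Filter.Eventually.of_forall fun ω => by
      rw [Real.norm_eq_abs, abs_of_nonneg (h0 ω)]; exact h1 ω)
  calc ∫ ω, Real.exp (X ω) ∂P ≤ ∫ ω, (1 + 2 * X ω) ∂P := by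
        refine integral_mono_of_nonneg (Filter.Eventually.of_forall fun ω => (Real.exp_pos _).le)
          ((integrable_const 1).add (hi.const_mul 2)) (Filter.Eventually.of_forall fun ω => ?_)
        have h := Real.abs_exp_sub_one_le (x := X ω) (by rw [abs_of_nonneg (h0 ω)]; exact h1 ω)
        rw [abs_of_nonneg (h0 ω)] at h
        have := le_abs_self (Real.exp (X ω) - 1)
        simp only
        linarith
    _ = 2 * ∫ ω, X ω ∂P + 1 := by
        rw [integral_add (integrable_const 1) (hi.const_mul 2), integral_const_mul]
        simp [add_comm]
    _ ≤ _ := Real.add_one_le_exp _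

/-- The expected divergence of two runs that differ in the example of the update `k + 1`. -/
lemma IsRegularLoss.integral_divergence_le (hf : IsRegularLoss f L β ρ)
    (hT : 1 ≤ T) (hTm : T ≤ m) (hσ : 0 ≤ σ) (hc : 0 < c) (hcβ : c * β ≤ 1)
    (hvar : HasGradientVariance D f (fun t => c / t) w₁ m T σ)
    (hclog : c * (2 * (2 * β * Real.log T)) ≤ 1)
    (hγ : 8 * min β ((∫ z, ‖lossHess f w₁ z‖ ∂D) + (1 + Real.log T) *
      (ρ * (c * σ + Real.sqrt (c * (risk D f w₁ - ⨅ w, risk D f w))))) ≤ γ)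
    (k : Fin m) {n : ℕ} (hkn : (k : ℕ) + 1 ≤ n) (hnT : n ≤ T) :
    Integrable (divergence f (fun t => c / t) w₁ k n) ((sampleLaw D m).prod D) ∧
    ∫ p, divergence f (fun t => c / t) w₁ k n p ∂((sampleLaw D m).prod D)
      ≤ c / ((k + 1 : ℕ) : ℝ) * (2 * L) * ((T : ℝ) / ((k + 1 : ℕ) : ℝ)) ^ (c * γ) := by
  set P := (sampleLaw D m).prod D
  set Q := (∫ z, ‖lossHess f w₁ z‖ ∂D) + (1 + Real.log T) *
      (ρ * (c * σ + Real.sqrt (c * (risk D f w₁ - ⨅ w, risk D f w)))) with hQ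
  have hβ := hf.smooth_pos
  have hρ := hf.lipschitzHessian_nonneg
  have hL := hf.lipschitz_nonneg
  have hT1 : (1 : ℝ) ≤ T := Nat.one_le_cast.2 hT
  have hk1 : (1 : ℝ) ≤ ((k + 1 : ℕ) : ℝ) := Nat.one_le_cast.2 (by omega)
  have hn0 : (0 : ℝ) < n := Nat.cast_pos.2 (by omega)
  have hα : ∀ t : ℕ, 0 ≤ c / (t : ℝ) := fun t => by positivity
  let ξ : ℕ → (Fin m → Z) × Z → ℝ := pathCurvature f β ρ (fun t => c / t) w₁ k
  have hξ0 : ∀ s p, 0 ≤ ξ s p := fun s p => hf.pathCurvature_nonneg k s p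
  have hξβ : ∀ s p, ξ s p ≤ β := fun s p => min_le_left _ _
  have hξi : ∀ s, Integrable (ξ s) P := fun s =>
    Integrable.of_bound (hf.measurable_pathCurvature k s).aestronglyMeasurable β
      (Filter.Eventually.of_forall fun p => by
        rw [Real.norm_eq_abs, abs_of_nonneg (hξ0 s p)]; exact hξβ s p)
  let X : (Fin m → Z) × Z → ℝ := fun p =>
    ∑ s ∈ Finset.Ico ((k : ℕ) + 1) n, c / ((s + 1 : ℕ) : ℝ) * ξ s p
  have hXm : Measurable X := Finset.measurable_sum _ fun s _ =>
    (hf.measurable_pathCurvature k s).const_mul _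
  have hX0 : ∀ p, 0 ≤ X p := fun p => Finset.sum_nonneg fun s _ => mul_nonneg (hα _) (hξ0 s p)
  set ℓ := Real.log (n / ((k + 1 : ℕ) : ℝ)) with hℓ
  have hℓT : ℓ ≤ Real.log (T / ((k + 1 : ℕ) : ℝ)) := Real.log_le_log (by positivity) (by gcongr)
  have hℓT' : ℓ ≤ Real.log T := hℓT.trans
    (Real.log_le_log (by positivity) (div_le_self (by positivity) hk1))
  have hℓ0 : 0 ≤ ℓ := Real.log_nonneg ((one_le_div (by positivity)).2 (by exact_mod_cast hkn))
  have hsum : ∀ {y : ℕ → ℝ} {B : ℝ}, 0 ≤ B → (∀ s < n, y s ≤ B) →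
      ∑ s ∈ Finset.Ico ((k : ℕ) + 1) n, c / ((s + 1 : ℕ) : ℝ) * y s ≤ c * B * ℓ := by
    intro y B hB hy
    calc _ ≤ ∑ s ∈ Finset.Ico ((k : ℕ) + 1) n, c * B * (1 / ((s + 1 : ℕ) : ℝ)) := by
          refine Finset.sum_le_sum fun s hs => ?_
          refine (mul_le_mul_of_nonneg_left (hy s (Finset.mem_Ico.1 hs).2) (hα _)).trans_eq ?_
          ring
      _ ≤ _ := by
          rw [← Finset.mul_sum]
          exact mul_le_mul_of_nonneg_left (sum_Ico_inv_le_log hkn) (by positivity)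
  have hXβ : ∀ p, X p ≤ c * β * ℓ := fun p => hsum hβ.le fun s _ => hξβ s p
  -- The step size condition gives `c β log T ≤ 1 / 4`.
  have hX1 : ∀ p, X p ≤ 1 := fun p => by
    have := mul_le_mul_of_nonneg_left hℓT' (mul_pos hc hβ).le
    have := mul_nonneg (mul_pos hc hβ).le (hℓ0.trans hℓT')
    linarith [hXβ p]
  have hexp : ∫ p, Real.exp (X p) ∂P ≤ ((T : ℝ) / ((k + 1 : ℕ) : ℝ)) ^ (c * γ) := by
    -- The factor `8 = 2 * 4`: `2` from `integral_exp_le`, and `4` from the two runs, each of which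
    -- travels at most twice the distance that `Q` accounts for.
    have hγ0 : ∀ b, 8 * b ≤ γ → 0 ≤ b → Real.exp (2 * (c * (4 * b) * ℓ))
        ≤ ((T : ℝ) / ((k + 1 : ℕ) : ℝ)) ^ (c * γ) := by
      intro b hb hb0
      rw [Real.rpow_def_of_pos (by positivity)]
      refine Real.exp_le_exp.2 ?_
      calc 2 * (c * (4 * b) * ℓ) = ℓ * (c * (8 * b)) := by ring
        _ ≤ _ := by gcongr; exact hℓ0.trans hℓT
    refine (integral_exp_le hXm hX0 hX1).trans ?_
    have hXi : ∫ p, X p ∂P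
        = ∑ s ∈ Finset.Ico ((k : ℕ) + 1) n, c / ((s + 1 : ℕ) : ℝ) * ∫ p, ξ s p ∂P := by
      simp only [X]
      rw [integral_finsetSum _ fun s _ => (hξi s).const_mul _]
      exact Finset.sum_congr rfl fun s _ => integral_const_mul _ _
    rw [hXi]
    have hH0 : 0 ≤ ∫ z, ‖lossHess f w₁ z‖ ∂D := integral_nonneg fun z => norm_nonneg _
    have hlog0 : 0 ≤ Real.log T := Real.log_nonneg hT1
    have hQ0 : 0 ≤ Q := by positivity
    rcases min_choice β Q with h | h <;> rw [h] at hγ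
    · refine le_trans (Real.exp_le_exp.2 ?_) (hγ0 β hγ hβ.le)
      refine mul_le_mul_of_nonneg_left (hsum (by positivity) fun s _ => ?_) (by norm_num)
      refine (integral_mono (hξi s) (integrable_const β) (hξβ s)).trans ?_
      simp only [integral_const, probReal_univ, one_smul]
      linarith
    · refine le_trans (Real.exp_le_exp.2 ?_) (hγ0 Q hγ hQ0)
      refine mul_le_mul_of_nonneg_left (hsum (by positivity) fun s hs => ?_) (by norm_num)
      refine (hf.integral_pathCurvature_le (D := D) k (by omega)
        (hf.integral_norm_sgdAfter_sub_le hT hTm hσ hc hcβ hvar (by omega : s ≤ T))).trans ?_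
      rw [hQ]
      linarith
  have hle : ∀ p, divergence f (fun t => c / t) w₁ k n p
      ≤ c / ((k + 1 : ℕ) : ℝ) * (2 * L) * Real.exp (X p) := fun p => by
    exact hf.divergence_le (α := fun t => c / t) hα k hkn p
  have hint : Integrable (fun p => c / ((k + 1 : ℕ) : ℝ) * (2 * L) * Real.exp (X p)) P := by
    refine Integrable.const_mul (Integrable.of_bound
      (Real.measurable_exp.comp hXm).aestronglyMeasurable (Real.exp 1)
      (Filter.Eventually.of_forall fun p => ?_)) _
    rw [Function.comp_apply, Real.norm_eq_abs, Real.abs_exp]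
    exact Real.exp_le_exp.2 (hX1 p)
  have hdi : Integrable (divergence f (fun t => c / t) w₁ k n) P :=
    hint.mono' (hf.measurable_divergence k n).aestronglyMeasurable
      (Filter.Eventually.of_forall fun p => by
        rw [divergence, norm_norm]; exact hle p)
  refine ⟨hdi, (integral_mono hdi hint hle).trans ?_⟩
  rw [integral_const_mul]
  gcongr

end Divergence

/-! ### The trade-off between early and late replacements -/

/-- Tangent line inequality for the convex function `x ↦ x ^ (-a)`. -/
lemma mul_rpow_le_rpow_neg_sub {a x y : ℝ} (ha : 0 < a) (hx : 0 < x) (hy : 0 < y) :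
    (y - x) * y ^ (-(1 + a)) ≤ (x ^ (-a) - y ^ (-a)) / a := by
  have h1 : 1 - a * (x / y - 1) ≤ (x / y) ^ (-a) := by
    rw [Real.rpow_def_of_pos (by positivity)]
    have h2 := Real.log_le_sub_one_of_pos (div_pos hx hy)
    have h3 := Real.add_one_le_exp (Real.log (x / y) * -a)
    nlinarith
  have h4 : y ^ (-(1 + a)) = y ^ (-a) / y := by
    rw [show -(1 + a) = -a - 1 by ring, Real.rpow_sub_one hy.ne']
  have h5 : x ^ (-a) = (x / y) ^ (-a) * y ^ (-a) := by
    rw [← Real.mul_rpow (by positivity) hy.le, div_mul_cancel₀ _ hy.ne']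
  rw [le_div_iff₀ ha, h4, h5]
  calc (y - x) * (y ^ (-a) / y) * a = (1 - a * (x / y - 1) - 1) * y ^ (-a) := by field_simp; ring
    _ ≤ ((x / y) ^ (-a) - 1) * y ^ (-a) := by gcongr
    _ = _ := by ring

/-- The increments of a concave function dominate its derivative `min r (B x ^ (-(1 + a)))`, whose
two branches meet at `t`. -/
lemma sum_min_le {a r B t : ℝ} (ha : 0 < a) (hr : 0 ≤ r) (hB : 0 ≤ B) (ht : 0 < t) (n : ℕ) :
    ∑ k ∈ Finset.range n, min r (B * ((k + 1 : ℕ) : ℝ) ^ (-(1 + a)))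
      ≤ r * t + B * t ^ (-a) / a := by
  let Ψ : ℝ → ℝ := fun x => if x ≤ t then r * x else r * t + B / a * (t ^ (-a) - x ^ (-a))
  have hstep : ∀ k : ℕ, min r (B * ((k + 1 : ℕ) : ℝ) ^ (-(1 + a)))
      ≤ Ψ ((k + 1 : ℕ) : ℝ) - Ψ k := by
    intro k
    have hk : (0 : ℝ) < ((k + 1 : ℕ) : ℝ) := by positivity
    have hkk : (k : ℝ) = ((k + 1 : ℕ) : ℝ) - 1 := by push_cast; ring
    have hpos : ∀ x : ℝ, 0 < x → B * ((((k + 1 : ℕ) : ℝ) - x) * ((k + 1 : ℕ) : ℝ) ^ (-(1 + a)))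
        ≤ B / a * (x ^ (-a) - ((k + 1 : ℕ) : ℝ) ^ (-a)) := fun x hx => by
      refine (mul_le_mul_of_nonneg_left (mul_rpow_le_rpow_neg_sub ha hx hk) hB).trans_eq ?_
      ring
    simp only [Ψ]
    by_cases h1 : ((k + 1 : ℕ) : ℝ) ≤ t
    · rw [if_pos h1, if_pos (by linarith)]
      refine (min_le_left _ _).trans_eq ?_
      rw [hkk]; ring
    · rw [if_neg h1]
      push Not at h1
      by_cases h2 : (k : ℝ) ≤ t
      · rw [if_pos h2]
        have h3 := hpos t ht
        set u := B * ((k + 1 : ℕ) : ℝ) ^ (-(1 + a)) with hu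
        have h4 : (((k + 1 : ℕ) : ℝ) - t) * min r u ≤ (((k + 1 : ℕ) : ℝ) - t) * u :=
          mul_le_mul_of_nonneg_left (min_le_right _ _) (by linarith)
        have h5 : (t - k) * min r u ≤ (t - k) * r :=
          mul_le_mul_of_nonneg_left (min_le_left _ _) (by linarith)
        have h6 : min r u = (((k + 1 : ℕ) : ℝ) - t) * min r u + (t - k) * min r u := by
          rw [hkk]; ring
        have h7 : (((k + 1 : ℕ) : ℝ) - t) * u
            = B * ((((k + 1 : ℕ) : ℝ) - t) * ((k + 1 : ℕ) : ℝ) ^ (-(1 + a))) := by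
          rw [hu]; ring
        linarith
      · rw [if_neg h2]
        push Not at h2
        have h3 := hpos k (ht.trans h2)
        rw [show ((k + 1 : ℕ) : ℝ) - k = 1 by push_cast; ring, one_mul] at h3
        have h4 := min_le_right r (B * ((k + 1 : ℕ) : ℝ) ^ (-(1 + a)))
        linarith
  have hΨ0 : Ψ ((0 : ℕ) : ℝ) = 0 := by simp [Ψ, ht.le]
  have h0 : 0 ≤ B * t ^ (-a) / a := by positivity
  calc _ ≤ ∑ k ∈ Finset.range n, (Ψ ((k + 1 : ℕ) : ℝ) - Ψ k) :=
        Finset.sum_le_sum fun k _ => hstep k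
    _ = Ψ n := by rw [Finset.sum_range_sub (fun k : ℕ => Ψ k), hΨ0, sub_zero]
    _ ≤ _ := by
        simp only [Ψ]
        split_ifs with h
        · have := mul_le_mul_of_nonneg_left h hr
          linarith
        · have h1 : 0 ≤ B / a * (n : ℝ) ^ (-a) := by positivity
          have h2 : B / a * (t ^ (-a) - (n : ℝ) ^ (-a))
            = B * t ^ (-a) / a - B / a * (n : ℝ) ^ (-a) := by ring
          linarith

/-- The optimal choice `t = (B / r) ^ (1 / (1 + a))` in `sum_min_le`. -/
lemma sum_min_le_rpow {a r B : ℝ} (ha : 0 < a) (hr : 0 ≤ r) (hB : 0 ≤ B) (n : ℕ) :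
    ∑ k ∈ Finset.range n, min r (B * ((k + 1 : ℕ) : ℝ) ^ (-(1 + a)))
      ≤ (1 + 1 / a) * (B ^ (1 / (1 + a)) * r ^ (a / (1 + a))) := by
  have hnn : 0 ≤ (1 + 1 / a) * (B ^ (1 / (1 + a)) * r ^ (a / (1 + a))) := by positivity
  rcases hr.eq_or_lt with rfl | hr
  · exact (Finset.sum_nonpos fun k _ => min_le_left _ _).trans hnn
  rcases hB.eq_or_lt with rfl | hB
  · exact (Finset.sum_nonpos fun k _ => (min_le_right _ _).trans_eq (zero_mul _)).trans hnn
  have h1a : 1 + a ≠ 0 := by positivity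
  set t := (B / r) ^ (1 / (1 + a)) with ht
  have ht0 : 0 < t := by positivity
  have hrt : r * t = B ^ (1 / (1 + a)) * r ^ (a / (1 + a)) := by
    have : a / (1 + a) = 1 - 1 / (1 + a) := by field_simp; ring
    rw [ht, Real.div_rpow hB.le hr.le, this, Real.rpow_sub hr, Real.rpow_one]
    ring
  have hta : B * t ^ (-a) = r * t := by
    have h2 : t ^ (1 + a) = B / r := by
      rw [ht, ← Real.rpow_mul (by positivity), one_div_mul_cancel h1a, Real.rpow_one]
    rw [Real.rpow_add ht0, Real.rpow_one] at h2
    rw [Real.rpow_neg ht0.le]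
    have h3 : (0:ℝ) < t ^ a := by positivity
    field_simp at h2 ⊢
    linarith
  refine (sum_min_le ha hr.le hB.le ht0 n).trans_eq ?_
  rw [hta, hrt]
  ring

lemma sum_fin_ite_lt {m n : ℕ} (hn : n ≤ m) (h : ℕ → ℝ) :
    ∑ k : Fin m, (if (k : ℕ) < n then h k else 0) = ∑ k ∈ Finset.range n, h k := by
  rw [Fin.sum_univ_eq_sum_range (fun k => if k < n then h k else 0) m, ← Finset.sum_filter]
  congr 1
  ext k
  simp only [Finset.mem_filter, Finset.mem_range]
  omega

/-! ### On-average stability -/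

section Stability

variable {d m : ℕ} {Z : Type*} [MeasurableSpace Z]
  {f : EuclideanSpace ℝ (Fin d) → Z → ℝ} {w₁ : EuclideanSpace ℝ (Fin d)} {α : ℕ → ℝ}
  {L β ρ : ℝ}

/-- The mean effect of replacing the example of the update `k + 1`, for the natural order of the
examples, on the loss at the replacement after `n` updates. -/
noncomputable def replacementEffect (D : Measure Z) (f : EuclideanSpace ℝ (Fin d) → Z → ℝ)
    (α : ℕ → ℝ) (w₁ : EuclideanSpace ℝ (Fin d)) (n : ℕ) (k : Fin m) : ℝ :=
  ∫ p : (Fin m → Z) × Z, (f (sgdAfter f α w₁ p.1 1 n) p.2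
    - f (sgdAfter f α w₁ (Function.update p.1 k p.2) 1 n) p.2) ∂((sampleLaw D m).prod D)

lemma replacementEffect_eq_zero {D : Measure Z} {n : ℕ} {k : Fin m} (h : n ≤ k) :
    replacementEffect D f α w₁ n k = 0 := by
  simp [replacementEffect, sgdAfter_update_of_le _ _ k h]

variable {D : Measure Z} [IsProbabilityMeasure D]

/-- The expected risk does not depend on the order of the examples. -/
lemma expectedRisk_sgdIterate (n : ℕ) :
    expectedRisk D f (sgdIterate (m := m) f α w₁ (n + 1))
      = ∫ S, risk D f (sgdAfter f α w₁ S 1 n) ∂(sampleLaw D m) := by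
  have h : ∀ π : Equiv.Perm (Fin m),
      ∫ S, risk D f (sgdIterate f α w₁ (n + 1) S π) ∂(sampleLaw D m)
        = ∫ S, risk D f (sgdAfter f α w₁ S 1 n) ∂(sampleLaw D m) := fun π => by
    simp only [sgdIterate, Nat.add_sub_cancel]
    simp_rw [sgdAfter_eq_comp_perm (S := _) (π := π)]
    exact integral_comp_perm π fun S => risk D f (sgdAfter f α w₁ S 1 n)
  rw [expectedRisk]
  simp_rw [h, Fintype.expect_const]

lemma hasGradientVariance_of_expect {T : ℕ} {σ : ℝ}
    (h : ∀ t ∈ Finset.Icc 1 T,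
      𝔼 π : Equiv.Perm (Fin m), ∫ p : (Fin m → Z) × Z,
        ‖lossGrad f (sgdIterate f α w₁ t p.1 π) p.2
          - gradient (risk D f) (sgdIterate f α w₁ t p.1 π)‖ ^ 2
        ∂((sampleLaw D m).prod D) ≤ σ ^ 2) :
    HasGradientVariance D f α w₁ m T σ := by
  intro s hs
  have h1 := h (s + 1) (Finset.mem_Icc.2 ⟨by omega, by omega⟩)
  have h2 : ∀ π : Equiv.Perm (Fin m), ∫ p : (Fin m → Z) × Z,
        ‖lossGrad f (sgdIterate f α w₁ (s + 1) p.1 π) p.2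
          - gradient (risk D f) (sgdIterate f α w₁ (s + 1) p.1 π)‖ ^ 2
        ∂((sampleLaw D m).prod D) = ∫ p : (Fin m → Z) × Z,
        ‖lossGrad f (sgdAfter f α w₁ p.1 1 s) p.2
          - gradient (risk D f) (sgdAfter f α w₁ p.1 1 s)‖ ^ 2
        ∂((sampleLaw D m).prod D) := fun π => by
    simp only [sgdIterate, Nat.add_sub_cancel]
    simp_rw [sgdAfter_eq_comp_perm (S := _) (π := π)]
    exact integral_prod_comp_perm π fun p => ‖lossGrad f (sgdAfter f α w₁ p.1 1 s) p.2
      - gradient (risk D f) (sgdAfter f α w₁ p.1 1 s)‖ ^ 2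
  simpa only [h2, Fintype.expect_const] using h1

/-- A replaced example is met at a uniformly random position. -/
lemma expect_sgdIterate_sub (n : ℕ) (i : Fin m) :
    𝔼 π : Equiv.Perm (Fin m), ∫ p : (Fin m → Z) × Z,
      (f (sgdIterate f α w₁ (n + 1) p.1 π) p.2
        - f (sgdIterate f α w₁ (n + 1) (Function.update p.1 i p.2) π) p.2)
        ∂((sampleLaw D m).prod D)
      = (∑ k : Fin m, replacementEffect D f α w₁ n k) / m := by
  rw [← expect_perm_symm_apply _ i]
  refine Finset.expect_congr rfl fun π _ => ?_
  simp only [sgdIterate, Nat.add_sub_cancel]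
  simp_rw [sgdAfter_eq_comp_perm (S := _) (π := π), Function.update_comp_equiv]
  exact integral_prod_comp_perm π fun p => f (sgdAfter f α w₁ p.1 1 n) p.2
    - f (sgdAfter f α w₁ (Function.update p.1 (π.symm i) p.2) 1 n) p.2

lemma IsRegularLoss.integrable_loss_comp (hf : IsRegularLoss f L β ρ)
    {w : (Fin m → Z) × Z → EuclideanSpace ℝ (Fin d)} (hw : Measurable w) :
    Integrable (fun p : (Fin m → Z) × Z => f (w p) p.2) ((sampleLaw D m).prod D) :=
  Integrable.of_bound ((measurable_loss_uncurry hf.meas hf.contDiff).comp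
    (hw.prodMk measurable_snd)).aestronglyMeasurable 1 (Filter.Eventually.of_forall fun p => by
      have h := hf.mem_Icc (w p) p.2
      rw [Real.norm_eq_abs, abs_of_nonneg h.1]; exact h.2)

lemma IsRegularLoss.replacementEffect_le_risk (hf : IsRegularLoss f L β ρ) (n : ℕ) (k : Fin m) :
    replacementEffect D f α w₁ n k
      ≤ ∫ S, risk D f (sgdAfter f α w₁ S 1 n) ∂(sampleLaw D m) := by
  have h1 := hf.integrable_loss_comp (D := D)
    ((measurable_sgdAfter (α := α) (w₁ := w₁) (m := m) hf.meas hf.contDiff n).comp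
      measurable_fst)
  have h2 := hf.integrable_loss_comp (D := D)
    ((measurable_sgdAfter (α := α) (w₁ := w₁) (m := m) hf.meas hf.contDiff n).comp
      (measurable_replaceExample k))
  have h3 := integral_prod _ h1
  refine le_trans (integral_mono (h1.sub h2) h1 fun p => ?_) h3.le
  exact sub_le_self _ (hf.mem_Icc _ _).1

lemma IsRegularLoss.replacementEffect_le_divergence (hf : IsRegularLoss f L β ρ) (n : ℕ)
    (k : Fin m) (hi : Integrable (divergence f α w₁ k n) ((sampleLaw D m).prod D)) :
    replacementEffect D f α w₁ n k
      ≤ L * ∫ p, divergence f α w₁ k n p ∂((sampleLaw D m).prod D) := by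
  have h1 := hf.integrable_loss_comp (D := D)
    ((measurable_sgdAfter (α := α) (w₁ := w₁) (m := m) hf.meas hf.contDiff n).comp
      measurable_fst)
  have h2 := hf.integrable_loss_comp (D := D)
    ((measurable_sgdAfter (α := α) (w₁ := w₁) (m := m) hf.meas hf.contDiff n).comp
      (measurable_replaceExample k))
  rw [← integral_const_mul]
  refine integral_mono (h1.sub h2) (hi.const_mul L) fun p => ?_
  exact (le_abs_self _).trans (abs_loss_sub_le hf.contDiff hf.lipschitz _ _ _)

end Stability

theorem theorem2 :
    ∃ C : ℝ, 0 < C ∧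
      ∀ (d m T : ℕ) (Z : Type*) [MeasurableSpace Z] (D : Measure Z) [IsProbabilityMeasure D]
        (f : EuclideanSpace ℝ (Fin d) → Z → ℝ) (w₁ : EuclideanSpace ℝ (Fin d))
        (L β ρ σ c γ : ℝ),
        1 ≤ T → T ≤ m →
        0 < β → 0 ≤ ρ → 0 ≤ σ → 0 < c →
        -- the loss
        (∀ w, Measurable (f w)) →
        (∀ w z, f w z ∈ Set.Icc (0 : ℝ) 1) →
        (∀ z, ContDiff ℝ 2 (fun w => f w z)) →
        IsLipschitzLoss L f → IsSmoothLoss β f → HasLipschitzHessian ρ f →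
        -- the variance of the stochastic gradients along the iterates of SGD
        (∀ t ∈ Finset.Icc 1 T,
          𝔼 π : Equiv.Perm (Fin m), ∫ p : (Fin m → Z) × Z,
            ‖lossGrad f (sgdIterate f (fun t => c / t) w₁ t p.1 π) p.2
              - gradient (risk D f) (sgdIterate f (fun t => c / t) w₁ t p.1 π)‖ ^ 2
            ∂((sampleLaw D m).prod D) ≤ σ ^ 2) →
        -- the step size: c ≤ 1 / β, c ≤ 1 / (4 (2 β ln T)²) and c ≤ 1 / (2 (2 β ln T)),
        -- where the last two hold trivially for T = 1
        c * β ≤ 1 →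
        c * (4 * (2 * β * Real.log T) ^ 2) ≤ 1 →
        c * (2 * (2 * β * Real.log T)) ≤ 1 →
        -- the curvature parameter
        0 < γ →
        C * min β ((∫ z, ‖lossHess f w₁ z‖ ∂D) + (1 + Real.log T) *
          (ρ * (c * σ + Real.sqrt (c * (risk D f w₁ - ⨅ w, risk D f w))))) ≤ γ →
        -- the output: the T-th iterate, or the result of the T-th update
        ∀ τ : ℕ, τ = T ∨ τ = T + 1 →
          IsOnAverageStable D f (sgdIterate (m := m) f (fun t => c / t) w₁ τ)
            ((1 + 1 / (c * γ)) / m * (2 * c * L ^ 2) ^ (1 / (1 + c * γ)) *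
              (expectedRisk D f (sgdIterate (m := m) f (fun t => c / t) w₁ τ) * T)
                ^ (c * γ / (1 + c * γ))) := by

  refine ⟨8, by norm_num, ?_⟩
  intro d m T Z _ D _ f w₁ L β ρ σ c γ hT hTm hβ hρ hσ hc hm h01 hcd hL hs hH hvar hcβ _ hclog hγ
    hCγ τ hτ i
  obtain ⟨z₀⟩ : Nonempty Z := nonempty_of_isProbabilityMeasure D
  have hf : IsRegularLoss f L β ρ :=
    ⟨hm, h01, hcd, hL, hs, hH, (norm_nonneg _).trans (hL w₁ z₀), hβ, hρ⟩
  -- The output is the parameter after `n` updates, where `n = T - 1` or `n = T`.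
  obtain ⟨n, rfl, hnT⟩ : ∃ n, τ = n + 1 ∧ n ≤ T := ⟨τ - 1, by omega, by omega⟩
  have hvar' := hasGradientVariance_of_expect hvar
  rw [expect_sgdIterate_sub, expectedRisk_sgdIterate]
  set α : ℕ → ℝ := fun t => c / t with hα
  set r := ∫ S, risk D f (sgdAfter f α w₁ S 1 n) ∂(sampleLaw D m) with hr
  set a := c * γ with ha_def
  have ha : 0 < a := by positivity
  have hr0 : 0 ≤ r := integral_nonneg fun S => risk_nonneg h01 _
  have hL0 := hf.lipschitz_nonneg
  set B := 2 * c * L ^ 2 * (T : ℝ) ^ a with hB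
  have hB0 : 0 ≤ B := by positivity
  have hG : ∀ k : Fin m, replacementEffect D f α w₁ n k
      ≤ if (k : ℕ) < n then min r (B * (((k : ℕ) + 1 : ℕ) : ℝ) ^ (-(1 + a))) else 0 := by
    intro k
    split_ifs with h
    · obtain ⟨hi, hd⟩ := hf.integral_divergence_le hT hTm hσ hc hcβ hvar' hclog hCγ k h hnT
      refine le_min (hf.replacementEffect_le_risk n k)
        ((hf.replacementEffect_le_divergence n k hi).trans
          ((mul_le_mul_of_nonneg_left hd hL0).trans_eq ?_))
      have hk : (0 : ℝ) < (((k : ℕ) + 1 : ℕ) : ℝ) := by positivity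
      rw [Real.div_rpow (by positivity) hk.le, Real.rpow_neg hk.le, Real.rpow_add hk,
        Real.rpow_one, hB, ← ha_def]
      field_simp
    · exact (replacementEffect_eq_zero (not_lt.1 h)).le
  have hsum : ∑ k : Fin m, replacementEffect D f α w₁ n k
      ≤ (1 + 1 / a) * (B ^ (1 / (1 + a)) * r ^ (a / (1 + a))) := by
    refine (Finset.sum_le_sum fun k _ => hG k).trans ?_
    rw [sum_fin_ite_lt (hnT.trans hTm)
      fun k => min r (B * ((k + 1 : ℕ) : ℝ) ^ (-(1 + a)))]
    exact sum_min_le_rpow ha hr0 hB0 n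
  refine (div_le_div_of_nonneg_right hsum (Nat.cast_nonneg m)).trans_eq ?_
  rw [hB, Real.mul_rpow (by positivity) (by positivity), ← Real.rpow_mul (by positivity),
    Real.mul_rpow hr0 (by positivity), mul_one_div]
  ring
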